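/- Let $K$ be a field with a valuation $\mathrm{val}:K^*\to\mathbb R$ whose value group $\Gamma$ contains $\mathbb Q$ (so $\Gamma$ is dense in $\mathbb R$), with residue field $\Bbbk$, and fix a splitting of the valuation, i.e. a group homomorphism $\Gamma\to K^*$, $\gamma\mapsto t^\gamma$, with $\mathrm{val}(t^\gamma)=\gamma$. For a nonzero $f=\sum c_ux^u\in K[x_0,\dots,x_n]$ let $\mathrm{trop}(f)(w)=\min_{c_u\ne 0}(\mathrm{val}(c_u)+w\cdot u)$ for $w\in\mathbb R^{n+1}$. For $w\in\Gamma^{n+1}$ put $$\mathrm{in}_w(f)=\sum_{\mathrm{val}(c_u)+w\cdot u=\mathrm{trop}(f)(w)}\overline{t^{-\mathrm{val}(c_u)}c_u}\,x^u\in\Bbbk[x_0,\dots,x_n],$$ with $\mathrm{in}_w(0)=0$. For an ideal $I$ let $\mathrm{in}_w(I)=\langle \mathrm{in}_w(f):f\in I\rangle$ and $C_I[w]=\{w'\in\Gamma^{n+1}:\mathrm{in}_{w'}(I)=\mathrm{in}_w(I)\}$, and let $\overline{C_I[w]}$ be its closure in $\mathbb R^{n+1}$. Let $I\subseteq K[x_0,\dots,x_n]$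 be a homogeneous ideal. Then the degrees of the minimal generators of those initial ideals $\mathrm{in}_w(I)$, $w\in\Gamma^{n+1}$, that are monomial ideals are bounded. Let $D$ be their maximum ($D=0$ if there are none). For $1\le d\le D$ choose a basis $f_1,\dots,f_s$ of the degree $d$ part $I_d$ and an ordering of the set $\mathcal M_d$ of monomials of degree $d$, and let $A_d$ be the $s\times|\mathcal M_d|$ matrix of the coefficients of the $f_i$. Put $$g_d=\sum_{J\subseteq\mathcal M_d,\ |J|=s}\det(A_d^J)\prod_{x^u\in J}x^u,\qquad g=\prod_{d=1}^D g_d,$$ where $A_d^J$ is the submatrix of $A_d$ with columns in $J$ (so $g_d=1$ if $I_d=0$). Then $g\neq 0$, and among the polyhedral complexes that cover $\mathbb R^{n+1}$ and on each of whose polyhedra $\mathrm{trop}(g)$ is (affine) linear there is a coarsest one, $\Sigma_{\mathrm{trop}(g)}$: every other such complex refines it. For every maximal polyhedron $\sigma\in\Sigma_{\mathrm{trop}(g)}$ and every $w\in\Gamma^{n+1}$ in the interior of $\sigma$, $$\sigma=\overline{C_I[w]},$$ and $\mathrm{in}_w(I)$ is a monomial ideal. -/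

import Mathlib

namespace TropGrobner

open MvPolynomial

noncomputable section

/-! ### Real valuations, value group, residue field, splittings -/

section Valuation

variable {K : Type*} [Field K] (v : AddValuation K (WithTop ℝ))

/-- The real number `val a` for `a ≠ 0` (and the junk value `0` for `a = 0`, never used). -/
def val (a : K) : ℝ := (v a).untopD 0

theorem coe_val {a : K} (ha : a ≠ 0) : ((val v a : ℝ) : WithTop ℝ) = v a := by
  obtain ⟨r, hr⟩ := WithTop.ne_top_iff_exists.1 (fun h => ha ((AddValuation.top_iff v).1 h))
  rw [val, ← hr, WithTop.untopD_coe]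

/-- The value group `Γ ⊆ ℝ`: the image of `K \ {0}` under the valuation. -/
def valueGroup : AddSubgroup ℝ where
  carrier := {r | ∃ a : K, a ≠ 0 ∧ v a = (r : WithTop ℝ)}
  zero_mem' := ⟨1, one_ne_zero, by simp⟩
  add_mem' := by
    rintro r s ⟨a, ha, hr⟩ ⟨b, hb, hs⟩
    exact ⟨a * b, mul_ne_zero ha hb, by simp [hr, hs]⟩
  neg_mem' := by
    rintro r ⟨a, ha, hr⟩
    refine ⟨a⁻¹, inv_ne_zero ha, ?_⟩
    have h1 : v a + v a⁻¹ = 0 := by rw [← v.map_mul, mul_inv_cancel₀ ha, v.map_one]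
    have h2 := coe_val v (inv_ne_zero ha)
    rw [← h2, hr, ← WithTop.coe_add, ← WithTop.coe_zero, WithTop.coe_inj] at h1
    rw [← h2, WithTop.coe_inj]
    linarith

/-- The valuation ring `R = {a | val a ≥ 0}`. -/
def valRing : ValuationSubring K where
  carrier := {a | 0 ≤ v a}
  mul_mem' := by
    intro a b ha hb
    change 0 ≤ v (a * b)
    rw [v.map_mul]
    exact add_nonneg ha hb
  one_mem' := by simp
  add_mem' := by
    intro a b ha hb
    exact le_trans (le_min ha hb) (v.map_add a b)
  zero_mem' := by simp
  neg_mem' := by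
    intro a ha
    simpa using ha
  mem_or_inv_mem' := by
    intro a
    by_cases ha : a = 0
    · left; simp [ha]
    · have h1 : v a + v a⁻¹ = 0 := by rw [← v.map_mul, mul_inv_cancel₀ ha, v.map_one]
      by_contra hcon
      rw [not_or] at hcon
      have h2 : ¬ (0 ≤ v a) := hcon.1
      have h3 : ¬ (0 ≤ v a⁻¹) := hcon.2
      rw [← coe_val v ha, ← coe_val v (inv_ne_zero ha)] at h1
      rw [← coe_val v ha] at h2
      rw [← coe_val v (inv_ne_zero ha)] at h3
      norm_cast at h1 h2 h3
      linarith

/-- The residue field `𝕜 = R / 𝔪`. -/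
abbrev ResField : Type _ := IsLocalRing.ResidueField (valRing v)

open Classical in
/-- The class `ā ∈ 𝕜` of an element `a` of the valuation ring (and `0` for `a` outside it). -/
def residue (a : K) : ResField v :=
  if h : a ∈ valRing v then IsLocalRing.residue (valRing v) ⟨a, h⟩ else 0

theorem val_mem_valueGroup (a : K) : val v a ∈ valueGroup v := by
  by_cases ha : a = 0
  · have : val v a = 0 := by simp [val, ha]
    rw [this]; exact (valueGroup v).zero_mem
  · exact ⟨a, ha, (coe_val v ha).symm⟩

/-- A splitting of the valuation: a group homomorphism `Γ → K \ {0}`, `γ ↦ t ^ γ`, with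
`val (t ^ γ) = γ`. -/
structure Splitting where
  /-- the homomorphism `γ ↦ t ^ γ` -/
  hom : Multiplicative (valueGroup v) →* Kˣ
  val_hom : ∀ γ : valueGroup v,
    v ((hom (Multiplicative.ofAdd γ) : Kˣ) : K) = ((γ : ℝ) : WithTop ℝ)

variable {v}

/-- The power `t ^ γ`. -/
def Splitting.pow (t : Splitting v) (γ : valueGroup v) : K :=
  ((t.hom (Multiplicative.ofAdd γ) : Kˣ) : K)

/-- The leading coefficient of `a ∈ K`: the class of `t ^ (- val a) * a` in the residue field. -/
def Splitting.lead (t : Splitting v) (a : K) : ResField v :=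
  residue v (t.pow (-⟨val v a, val_mem_valueGroup v a⟩) * a)

end Valuation

/-! ### Tropical polynomials and initial ideals -/

section Initial

variable {K : Type*} [Field K] (v : AddValuation K (WithTop ℝ)) {n : ℕ}

/-- The dot product `w · u` of a real vector and an exponent vector. -/
def dot (w : Fin (n + 1) → ℝ) (u : Fin (n + 1) →₀ ℕ) : ℝ := ∑ i, w i * (u i : ℝ)

/-- `trop(f)(w) = min (val (c_u) + w · u)`, over the finitely many terms `c_u x^u` of `f ≠ 0`
(and `0` for `f = 0`). -/
def trop (f : MvPolynomial (Fin (n + 1)) K) (w : Fin (n + 1) → ℝ) : ℝ :=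
  ⨅ u : {u // u ∈ f.support}, (val v (f.coeff u.1) + dot w u.1)

variable {v}

/-- The real vector underlying a `Γ`-valued vector. -/
def toReal (w : Fin (n + 1) → valueGroup v) : Fin (n + 1) → ℝ := fun i => (w i : ℝ)

open Classical in
/-- The initial form `in_w(f)`: the sum of the `lead (c_u) x^u` over the terms `c_u x^u` of `f`
with `val (c_u) + w · u = trop(f)(w)`. -/
def initialForm (t : Splitting v) (w : Fin (n + 1) → valueGroup v)
    (f : MvPolynomial (Fin (n + 1)) K) : MvPolynomial (Fin (n + 1)) (ResField v) :=
  ∑ u ∈ f.support.filter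
      (fun u => val v (f.coeff u) + dot (toReal w) u = trop v f (toReal w)),
    monomial u (t.lead (f.coeff u))

/-- The initial ideal `in_w(I)`, generated by the initial forms of all elements of `I`. -/
def initialIdeal (t : Splitting v) (w : Fin (n + 1) → valueGroup v)
    (I : Ideal (MvPolynomial (Fin (n + 1)) K)) : Ideal (MvPolynomial (Fin (n + 1)) (ResField v)) :=
  Ideal.span (initialForm t w '' (I : Set (MvPolynomial (Fin (n + 1)) K)))

/-- The set `C_I[w] = {w' ∈ Γ^{n+1} | in_{w'}(I) = in_w(I)}`, as a subset of `ℝ^{n+1}`. -/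
def initialClass (t : Splitting v) (I : Ideal (MvPolynomial (Fin (n + 1)) K))
    (w : Fin (n + 1) → valueGroup v) : Set (Fin (n + 1) → ℝ) :=
  {x | ∃ w' : Fin (n + 1) → valueGroup v,
    toReal w' = x ∧ initialIdeal t w' I = initialIdeal t w I}

/-- An ideal generated by monomials. -/
def IsMonomialIdeal {F : Type*} [Field F] (M : Ideal (MvPolynomial (Fin (n + 1)) F)) : Prop :=
  ∃ S : Set (Fin (n + 1) →₀ ℕ), M = Ideal.span ((fun u => monomial u (1 : F)) '' S)

/-- `x^u` is a minimal (monomial) generator of the monomial ideal `M`: it lies in `M`, and no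
proper divisor of it does. -/
def IsMinimalGenerator {F : Type*} [Field F] (M : Ideal (MvPolynomial (Fin (n + 1)) F))
    (u : Fin (n + 1) →₀ ℕ) : Prop :=
  Minimal (fun u' => monomial u' (1 : F) ∈ M) u

/-- The degrees of the minimal generators of all the monomial initial ideals of `I`. -/
def generatorDegrees (t : Splitting v) (I : Ideal (MvPolynomial (Fin (n + 1)) K)) : Set ℕ :=
  {d | ∃ w : Fin (n + 1) → valueGroup v, IsMonomialIdeal (initialIdeal t w I) ∧
    ∃ u, IsMinimalGenerator (initialIdeal t w I) u ∧ u.degree = d}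

/-- The maximal degree `D` of a minimal generator of a monomial initial ideal of `I`
(`0` if there is no such generator, that is, if `I = 0`). -/
def degreeBound (t : Splitting v) (I : Ideal (MvPolynomial (Fin (n + 1)) K)) : ℕ :=
  sSup (generatorDegrees t I)

end Initial

/-! ### The Plücker polynomials -/

section Pluecker

variable {K : Type*} [Field K] {n : ℕ}

attribute [local instance] MvPolynomial.gradedAlgebra in
/-- A homogeneous ideal of `K[x_0, …, x_n]`, for the standard grading. -/
abbrev IsHomogeneousIdeal (I : Ideal (MvPolynomial (Fin (n + 1)) K)) : Prop :=
  I.IsHomogeneous (homogeneousSubmodule (Fin (n + 1)) K)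

/-- The degree `d` part `I_d` of an ideal, as a vector space over `K`. -/
def degreePart (I : Ideal (MvPolynomial (Fin (n + 1)) K)) (d : ℕ) :
    Submodule K (MvPolynomial (Fin (n + 1)) K) :=
  I.restrictScalars K ⊓ homogeneousSubmodule (Fin (n + 1)) K d

/-- The (exponents of the) monomials of degree `d` in `x_0, …, x_n`. -/
abbrev Mon (n d : ℕ) : Type := {u : Fin (n + 1) →₀ ℕ // u.degree = d}

/-- The polynomial `g_d = ∑_J det (A_d^J) ∏_{u ∈ J} x^u`, where the rows of `A_d` are the
coefficient vectors of the elements of a basis `b` of `I_d` (with `s` elements), its columns are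
the monomials of degree `d` in an order given by `e`, and `J` runs over the sets of `s` columns. -/
def plueckerPoly {I : Ideal (MvPolynomial (Fin (n + 1)) K)} {d s N : ℕ}
    (b : Module.Basis (Fin s) K (degreePart I d)) (e : Fin N ≃ Mon n d) :
    MvPolynomial (Fin (n + 1)) K :=
  let A : Matrix (Fin s) (Fin N) K := Matrix.of fun i j => coeff (e j).1 (b i).1
  ∑ J : {J : Finset (Fin N) // J.card = s},
    C (A.submatrix id (J.1.orderEmbOfFin J.2)).det * ∏ j ∈ J.1, monomial (e j).1 (1 : K)

variable {v : AddValuation K (WithTop ℝ)}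

/-- The polynomial `g = ∏_{d = 1}^D g_d`. -/
def groebnerPoly (t : Splitting v) (I : Ideal (MvPolynomial (Fin (n + 1)) K)) {s N : ℕ → ℕ}
    (b : ∀ d, Module.Basis (Fin (s d)) K (degreePart I d)) (e : ∀ d, Fin (N d) ≃ Mon n d) :
    MvPolynomial (Fin (n + 1)) K :=
  ∏ d ∈ Finset.Icc 1 (degreeBound t I), plueckerPoly (b d) (e d)

end Pluecker

/-! ### Polyhedral complexes -/

section Polyhedra

variable {m : ℕ}

/-- A polyhedron `{x | A x ≤ b}` in `ℝ^m`. -/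
def IsPolyhedron (P : Set (Fin m → ℝ)) : Prop :=
  ∃ (r : ℕ) (A : Matrix (Fin r) (Fin m) ℝ) (b : Fin r → ℝ), P = {x | A.mulVec x ≤ b}

/-- `F` is a (nonempty) face of `P`: the set of points of `P` where some linear functional attains
its maximum over `P`. The functional `0` gives `P` itself. -/
def IsFace (F P : Set (Fin m → ℝ)) : Prop := F.Nonempty ∧ IsExposed ℝ P F

/-- A polyhedral complex in `ℝ^m`: a collection of nonempty polyhedra that contains all faces of
its members, such that any two members that meet do so in a common face. -/
structure PolyComplex (m : ℕ) where
  /-- the polyhedra of the complex -/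
  cells : Set (Set (Fin m → ℝ))
  isPolyhedron : ∀ P ∈ cells, IsPolyhedron P
  nonempty : ∀ P ∈ cells, P.Nonempty
  face_mem : ∀ P ∈ cells, ∀ F, IsFace F P → F ∈ cells
  inter_face : ∀ P ∈ cells, ∀ Q ∈ cells, (P ∩ Q).Nonempty → IsFace (P ∩ Q) P ∧ IsFace (P ∩ Q) Q

/-- The restriction of `f` to `P` is (affine) linear. -/
def IsLinearOn (f : (Fin m → ℝ) → ℝ) (P : Set (Fin m → ℝ)) : Prop :=
  ∃ (a : Fin m → ℝ) (c : ℝ), ∀ x ∈ P, f x = (∑ i, a i * x i) + c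

/-- A polyhedral complex that covers `ℝ^m`, with `f` linear on each of its polyhedra. -/
def PolyComplex.Linearizes (S : PolyComplex m) (f : (Fin m → ℝ) → ℝ) : Prop :=
  ⋃₀ S.cells = Set.univ ∧ ∀ P ∈ S.cells, IsLinearOn f P

/-- `S` is the coarsest polyhedral complex covering `ℝ^m` with `f` linear on each polyhedron:
every such complex refines it. -/
def PolyComplex.IsCoarsest (S : PolyComplex m) (f : (Fin m → ℝ) → ℝ) : Prop :=
  S.Linearizes f ∧ ∀ S' : PolyComplex m, S'.Linearizes f → ∀ P ∈ S'.cells, ∃ Q ∈ S.cells, P ⊆ Q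

end Polyhedra

end

end TropGrobner

open TropGrobner

/-! Call a set J of columns with nonzero minor of A_d a basis, with weight val(det A_d^J) + y·(sum
of the exponents in J) at y, and let B = (A_d^J)⁻¹A_d. Exchanging the i-th column of J for a column
j outside J multiplies the minor by ±B_ij. So if J has minimal weight, then val(B_ij) ≥ y·(ε(J_i) −
ε(j)) for all i, j (`IsArgmin.le_reduced`). The rows of B are then elements of I_d whose initial
forms have an identity matrix in the columns J and span in_w(I)_d (`eq_sum_of_mem_initialPart`).
Hence in_w(I) has the Hilbert function of I. If J is the only minimal basis, in_w(I)_d is spanned by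
the monomials in J; if in_w(I) is monomial, every minimal basis consists of its monomials of degree
d.

Different bases can have the same exponent, so terms of g may cancel. But where no two bases with
different exponents have equal weight, an exchange shows that the minimal basis is unique
(`IsArgmin.lt_of_exp_eq`), so each g_d, and therefore g, has one dominant monomial. Such points are
dense by Baire. Thus g ≠ 0, and by continuity trop(g) is everywhere the sum over 1 ≤ d ≤ D of the
minimal weights (`trop_groebnerPoly`).

The cells of the coarsest complex are the sets on which the terms minimal at a given point stay
minimal (`minComplex`). On a cell σ with interior points, trop(g) is affine and a sum of concave
functions; so a basis minimal at an interior point is minimal on all of σ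
(`IsArgmin.of_affine_sum`). Comparison with a generic interior point shows that for d ≤ D the
minimal basis J_d is unique and constant on the interior.

Degrees above D remain. The bases J_d at a generic point, for all d, form an upward closed set U
with the Hilbert function of I. The Hilbert function alone bounds the degrees of the generators
(`exists_degree_bound_of_hilbert`), so a perturbation of the generic point into Γ^{n+1} realizes U
as the monomials of an initial ideal, and the generators of U have degree at most D. An initial
ideal containing U in degrees at most D therefore contains all of U, and equals its span by equality
of Hilbert functions (`initialIdeal_eq_span`). Conversely, in_{w'}(I) = in_w(I) makes every J_d
minimal at w', so trop(g) agrees at w' with its affine form on σ, and w' ∈ σ. Density of Γ gives the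
closure. -/

namespace TropGrobner

open MvPolynomial

/-! ### Minima of finitely many affine functions -/

section TropMin

variable {n : ℕ}

theorem dot_add_left (x y : Fin (n + 1) → ℝ) (u : Fin (n + 1) →₀ ℕ) :
    dot (x + y) u = dot x u + dot y u := by
  simp [dot, add_mul, Finset.sum_add_distrib]

theorem dot_smul_left (r : ℝ) (x : Fin (n + 1) → ℝ) (u : Fin (n + 1) →₀ ℕ) :
    dot (r • x) u = r * dot x u := by
  simp [dot, mul_assoc, Finset.mul_sum]

theorem dot_add_right (x : Fin (n + 1) → ℝ) (u u' : Fin (n + 1) →₀ ℕ) :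
    dot x (u + u') = dot x u + dot x u' := by
  simp [dot, mul_add, Finset.sum_add_distrib]

theorem dot_zero_right (x : Fin (n + 1) → ℝ) : dot x 0 = 0 := by simp [dot]

theorem dot_sum_right {ι : Type*} (x : Fin (n + 1) → ℝ) (s : Finset ι)
    (u : ι → Fin (n + 1) →₀ ℕ) : dot x (∑ i ∈ s, u i) = ∑ i ∈ s, dot x (u i) := by
  classical
  induction s using Finset.induction_on with
  | empty => simp [dot_zero_right]
  | insert a s ha ih => rw [Finset.sum_insert ha, Finset.sum_insert ha, dot_add_right, ih]

theorem dot_single_one (x : Fin (n + 1) → ℝ) (i : Fin (n + 1)) :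
    dot x (Finsupp.single i 1) = x i := by
  classical
  simp [dot, Finsupp.single_apply]

theorem dot_pi_single (i : Fin (n + 1)) (u : Fin (n + 1) →₀ ℕ) :
    dot (Pi.single i 1) u = u i := by
  classical
  simp [dot, Pi.single_apply]

theorem continuous_dot (u : Fin (n + 1) →₀ ℕ) :
    Continuous fun y : Fin (n + 1) → ℝ => dot y u := by
  unfold dot
  fun_prop

/-- The affine function `y ↦ c + y · u`. -/
def aff (c : ℝ) (u : Fin (n + 1) →₀ ℕ) (y : Fin (n + 1) → ℝ) : ℝ := c + dot y u

theorem continuous_aff (c : ℝ) (u : Fin (n + 1) →₀ ℕ) :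
    Continuous (aff c u) := continuous_const.add (continuous_dot u)

theorem aff_combo {α β : ℝ} (h : α + β = 1) (c : ℝ) (u : Fin (n + 1) →₀ ℕ)
    (x y : Fin (n + 1) → ℝ) : aff c u (α • x + β • y) = α * aff c u x + β * aff c u y := by
  simp only [aff, dot_add_left, dot_smul_left]
  linear_combination (-c) * h

/-- The segment from x to w can be prolonged beyond w inside P. With this, w is a proper convex
combination of x and a point of P, even if x lies outside P. -/
theorem exists_line_mem {P : Set (Fin (n + 1) → ℝ)} {w : Fin (n + 1) → ℝ} (hw : w ∈ interior P)
    (x : Fin (n + 1) → ℝ) : ∃ ε : ℝ, 0 < ε ∧ w + ε • (w - x) ∈ P := by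
  have hc : Filter.Tendsto (fun ε : ℝ => w + ε • (w - x)) (nhds 0) (nhds w) := by
    have : Continuous fun ε : ℝ => w + ε • (w - x) := by fun_prop
    simpa using this.tendsto 0
  have h1 : ∀ᶠ ε : ℝ in nhdsWithin 0 (Set.Ioi 0), w + ε • (w - x) ∈ P :=
    (hc.eventually (mem_interior_iff_mem_nhds.1 hw)).filter_mono nhdsWithin_le_nhds
  obtain ⟨ε, h2, h3⟩ := (h1.and self_mem_nhdsWithin).exists
  exact ⟨ε, h3, h2⟩

theorem eq_combo {ε : ℝ} (hε : 0 < ε) (w x : Fin (n + 1) → ℝ) :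
    w = (1 / (1 + ε)) • (w + ε • (w - x)) + (ε / (1 + ε)) • x := by
  have : (1 + ε) ≠ 0 := by positivity
  ext i
  simp
  field_simp
  ring

theorem combo_add {ε : ℝ} (hε : 0 < ε) : (1 / (1 + ε)) + (ε / (1 + ε)) = 1 := by
  have : (1 + ε) ≠ 0 := by positivity
  field_simp

/-- An affine function that is nonnegative on a set and zero at an interior point is zero. -/
theorem aff_eq_of_le_of_interior {P : Set (Fin (n + 1) → ℝ)} {w : Fin (n + 1) → ℝ}
    (hw : w ∈ interior P) {c c' : ℝ} {u u' : Fin (n + 1) →₀ ℕ}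
    (hle : ∀ x ∈ P, aff c u x ≤ aff c' u' x) (heq : aff c u w = aff c' u' w) :
    c = c' ∧ u = u' := by
  have key : ∀ x, aff c u x ≥ aff c' u' x := by
    intro x
    obtain ⟨ε, hε, hm⟩ := exists_line_mem hw x
    have h1 := hle _ hm
    have e1 := aff_combo (combo_add hε) c u (w + ε • (w - x)) x
    have e2 := aff_combo (combo_add hε) c' u' (w + ε • (w - x)) x
    rw [← eq_combo hε w x] at e1 e2
    have hp : 0 < 1 / (1 + ε) := by positivity
    have hq : 0 < ε / (1 + ε) := by positivity
    by_contra hcon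
    push Not at hcon
    nlinarith [mul_le_mul_of_nonneg_left h1 hp.le, mul_lt_mul_of_pos_left hcon hq]
  have key2 : ∀ x, aff c u x = aff c' u' x := by
    intro x
    refine le_antisymm ?_ (key x)
    -- Reflection in w, where the two functions agree, reverses the inequality.
    have := key ((2 : ℝ) • w + (-1 : ℝ) • x)
    rw [ge_iff_le, aff_combo (by norm_num), aff_combo (by norm_num)] at this
    linarith
  have hc : c = c' := by simpa [aff, dot] using key2 0
  refine ⟨hc, ?_⟩
  ext i
  have := key2 (Pi.single i 1)
  simp only [aff, dot_pi_single, hc] at this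
  exact_mod_cast add_left_cancel this

variable {ι : Type*}

/-- The minimum of the affine functions `y ↦ c i + y · a i`. -/
noncomputable def tropMin (c : ι → ℝ) (a : ι → Fin (n + 1) →₀ ℕ) (y : Fin (n + 1) → ℝ) : ℝ :=
  ⨅ i, aff (c i) (a i) y

/-- The minimum of the affine functions `y ↦ c i + y · a i` is attained at `i`. -/
def IsArgmin (c : ι → ℝ) (a : ι → Fin (n + 1) →₀ ℕ) (y : Fin (n + 1) → ℝ) (i : ι) : Prop :=
  ∀ j, aff (c i) (a i) y ≤ aff (c j) (a j) y

variable {c : ι → ℝ} {a : ι → Fin (n + 1) →₀ ℕ} {y : Fin (n + 1) → ℝ}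

theorem exists_isArgmin [Finite ι] [Nonempty ι] (c : ι → ℝ) (a : ι → Fin (n + 1) →₀ ℕ)
    (y : Fin (n + 1) → ℝ) : ∃ i, IsArgmin c a y i :=
  Finite.exists_min fun i => aff (c i) (a i) y

theorem tropMin_le [Finite ι] (i : ι) : tropMin c a y ≤ aff (c i) (a i) y :=
  ciInf_le (Set.finite_range _).bddBelow i

theorem IsArgmin.tropMin_eq [Finite ι] {i : ι} (h : IsArgmin c a y i) :
    tropMin c a y = aff (c i) (a i) y :=
  have : Nonempty ι := ⟨i⟩
  le_antisymm (tropMin_le i) (le_ciInf h)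

theorem isArgmin_iff [Finite ι] {i : ι} :
    IsArgmin c a y i ↔ tropMin c a y = aff (c i) (a i) y :=
  ⟨fun h => h.tropMin_eq, fun h j => h ▸ tropMin_le j⟩

theorem continuous_tropMin [Finite ι] [Nonempty ι] (c : ι → ℝ) (a : ι → Fin (n + 1) →₀ ℕ) :
    Continuous (tropMin c a) := by
  have := Fintype.ofFinite ι
  have : tropMin c a = fun y =>
      Finset.univ.inf' Finset.univ_nonempty (fun i => aff (c i) (a i) y) := by
    ext y
    rw [tropMin, Finset.inf'_univ_eq_ciInf]
  rw [this]
  exact Continuous.finset_inf'_apply _ fun i _ => continuous_aff _ _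

theorem tropMin_concave [Finite ι] [Nonempty ι] {α β : ℝ} (hα : 0 ≤ α) (hβ : 0 ≤ β)
    (h : α + β = 1) (x y : Fin (n + 1) → ℝ) :
    α * tropMin c a x + β * tropMin c a y ≤ tropMin c a (α • x + β • y) := by
  refine le_ciInf fun i => ?_
  rw [aff_combo h]
  exact add_le_add (mul_le_mul_of_nonneg_left (tropMin_le i) hα)
    (mul_le_mul_of_nonneg_left (tropMin_le i) hβ)

/-- If `tropMin` is affine along a segment, a term that attains the minimum in the interior of the
segment attains it on the whole segment. -/
theorem IsArgmin.of_combo [Finite ι] {α β : ℝ} (hα : 0 ≤ α) (hβ : 0 < β) (h : α + β = 1)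
    {x y : Fin (n + 1) → ℝ}
    (heq : tropMin c a (α • x + β • y) = α * tropMin c a x + β * tropMin c a y) {i : ι}
    (hi : IsArgmin c a (α • x + β • y) i) : IsArgmin c a y i := by
  rw [hi.tropMin_eq, aff_combo h] at heq
  have h1 : tropMin c a x ≤ aff (c i) (a i) x := tropMin_le i
  have h2 : tropMin c a y ≤ aff (c i) (a i) y := tropMin_le i
  rw [isArgmin_iff]
  refine le_antisymm h2 ?_
  by_contra hcon
  push Not at hcon
  nlinarith [mul_le_mul_of_nonneg_left h1 hα, mul_lt_mul_of_pos_left hcon hβ]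

/-- If a sum of concave piecewise affine functions is affine on a set, a term that attains the
minimum in one of the summands at an interior point attains it on the whole set. -/
theorem IsArgmin.of_affine_sum {δ : Type*} {κ : δ → Type*} [∀ d, Finite (κ d)]
    [∀ d, Nonempty (κ d)] (s : Finset δ) (c : ∀ d, κ d → ℝ) (a : ∀ d, κ d → Fin (n + 1) →₀ ℕ)
    {P : Set (Fin (n + 1) → ℝ)} {c₀ : ℝ} {a₀ : Fin (n + 1) →₀ ℕ}
    (hf : ∀ x ∈ P, ∑ d ∈ s, tropMin (c d) (a d) x = aff c₀ a₀ x)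
    {w x : Fin (n + 1) → ℝ} (hw : w ∈ interior P) (hx : x ∈ P) {d : δ} (hd : d ∈ s) {i : κ d}
    (hi : IsArgmin (c d) (a d) w i) : IsArgmin (c d) (a d) x i := by
  obtain ⟨ε, hε, hm⟩ := exists_line_mem hw x
  set x' := w + ε • (w - x) with hx'
  have hα : 0 ≤ 1 / (1 + ε) := by positivity
  have hβ : 0 < ε / (1 + ε) := by positivity
  have hs := combo_add hε
  have hwx : w = (1 / (1 + ε)) • x' + (ε / (1 + ε)) • x := eq_combo hε w x
  set α := 1 / (1 + ε)
  set β := ε / (1 + ε)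
  have hle : ∀ d ∈ s, α * tropMin (c d) (a d) x' + β * tropMin (c d) (a d) x ≤
      tropMin (c d) (a d) w := fun d _ => by
    conv_rhs => rw [hwx]
    exact tropMin_concave hα hβ.le hs x' x
  have hsum : ∑ d ∈ s, (α * tropMin (c d) (a d) x' + β * tropMin (c d) (a d) x) =
      ∑ d ∈ s, tropMin (c d) (a d) w := by
    rw [Finset.sum_add_distrib, ← Finset.mul_sum, ← Finset.mul_sum, hf _ hm, hf _ hx,
      hf _ (interior_subset hw), ← aff_combo hs, ← hwx]
  -- Concavity gives an inequality for each summand and the sums are equal, so every inequality is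
  -- an equality.
  have heq := (Finset.sum_eq_sum_iff_of_le hle).1 hsum d hd
  rw [hwx] at hi heq
  exact IsArgmin.of_combo hα hβ hs heq.symm hi

end TropMin

/-! ### The coarsest complex on whose cells a minimum of affine functions is linear -/

section Coarsest

variable {n : ℕ} {ι : Type*} {c : ι → ℝ} {a : ι → Fin (n + 1) →₀ ℕ}

/-- The set of points where the terms minimal at `x` are minimal. -/
def minCell (c : ι → ℝ) (a : ι → Fin (n + 1) →₀ ℕ) (x : Fin (n + 1) → ℝ) :
    Set (Fin (n + 1) → ℝ) :=
  {y | ∀ i, IsArgmin c a x i → IsArgmin c a y i}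

theorem mem_minCell_self (x : Fin (n + 1) → ℝ) : x ∈ minCell c a x := fun _ h => h

theorem minCell_isPolyhedron [Finite ι] (c : ι → ℝ) (a : ι → Fin (n + 1) →₀ ℕ)
    (x : Fin (n + 1) → ℝ) : IsPolyhedron (minCell c a x) := by
  classical
  -- One inequality for each pair of a term minimal at x and an arbitrary term.
  obtain ⟨r, ⟨φ⟩⟩ := Finite.exists_equiv_fin ({i // IsArgmin c a x i} × ι)
  refine ⟨r, Matrix.of fun k l => (a (φ.symm k).1.1 l : ℝ) - (a (φ.symm k).2 l : ℝ),
    fun k => c (φ.symm k).2 - c (φ.symm k).1.1, ?_⟩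
  have key : ∀ (i j : ι) (y : Fin (n + 1) → ℝ),
      ∑ l, ((a i l : ℝ) - (a j l : ℝ)) * y l ≤ c j - c i ↔
        aff (c i) (a i) y ≤ aff (c j) (a j) y := by
    intro i j y
    have : ∑ l, ((a i l : ℝ) - (a j l : ℝ)) * y l = dot y (a i) - dot y (a j) := by
      rw [dot, dot, ← Finset.sum_sub_distrib]
      exact Finset.sum_congr rfl fun l _ => by ring
    rw [this, aff, aff]
    constructor <;> intro h <;> linarith
  ext y
  constructor
  · intro h k
    exact (key _ _ y).2 (h _ (φ.symm k).1.2 _)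
  · intro h i hi j
    have := h (φ (⟨i, hi⟩, j))
    simp only [Matrix.mulVec, dotProduct, Matrix.of_apply, Equiv.symm_apply_apply] at this
    exact (key _ _ y).1 this

theorem minCell_convex (x : Fin (n + 1) → ℝ) : Convex ℝ (minCell c a x) := by
  intro y hy z hz α β hα hβ h i hi j
  rw [aff_combo h, aff_combo h]
  exact add_le_add (mul_le_mul_of_nonneg_left (hy i hi j) hα)
    (mul_le_mul_of_nonneg_left (hz i hi j) hβ)

theorem minCell_isClosed (x : Fin (n + 1) → ℝ) : IsClosed (minCell c a x) := by
  simp only [minCell, IsArgmin, Set.ofPred_forall]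
  exact isClosed_iInter fun i => isClosed_iInter fun _ => isClosed_iInter fun j =>
    isClosed_le (continuous_aff _ _) (continuous_aff _ _)

/-- A convex set on which `tropMin` is affine is contained in the cell of one of its points. -/
theorem exists_subset_minCell [Finite ι] [Nonempty ι] {P : Set (Fin (n + 1) → ℝ)}
    (hP : Convex ℝ P) (hne : P.Nonempty)
    (hlin : ∀ x ∈ P, ∀ y ∈ P, tropMin c a ((1 / 2 : ℝ) • x + (1 / 2 : ℝ) • y) =
      1 / 2 * tropMin c a x + 1 / 2 * tropMin c a y) :
    ∃ x ∈ P, P ⊆ minCell c a x := by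
  -- A point of P with the fewest minimal terms serves as a relative interior point: the terms
  -- minimal at its midpoint with y are among those at x, hence are all of them, and they stay
  -- minimal at y.
  obtain ⟨x, hx, hmin⟩ : ∃ x ∈ P, ∀ y ∈ P, {i | IsArgmin c a x i}.ncard ≤
      {i | IsArgmin c a y i}.ncard := by
    obtain ⟨k, ⟨x, hx, rfl⟩, h⟩ := exists_minimal_of_wellFoundedLT
      (fun k => ∃ x ∈ P, {i | IsArgmin c a x i}.ncard = k) ⟨_, hne.choose, hne.choose_spec, rfl⟩
    exact ⟨x, hx, fun y hy => le_of_not_gt fun hlt => absurd (h ⟨y, hy, rfl⟩ hlt.le)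
      (not_le.2 hlt)⟩
  refine ⟨x, hx, fun y hy i hi => ?_⟩
  have hz := hP hx hy (by norm_num : (0 : ℝ) ≤ 1 / 2) (by norm_num : (0 : ℝ) ≤ 1 / 2) (by norm_num)
  have hxy := hlin x hx y hy
  have hyx := hlin y hy x hx
  have hcomm : (1 / 2 : ℝ) • y + (1 / 2 : ℝ) • x = (1 / 2 : ℝ) • x + (1 / 2 : ℝ) • y :=
    add_comm _ _
  have hsub : {i | IsArgmin c a ((1 / 2 : ℝ) • x + (1 / 2 : ℝ) • y) i} ⊆
      {i | IsArgmin c a x i} := fun j hj =>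
    IsArgmin.of_combo (by norm_num) (by norm_num) (by norm_num) hyx (hcomm ▸ hj)
  have := Set.eq_of_subset_of_ncard_le hsub (hmin _ hz) (Set.toFinite _)
  have hi' : i ∈ {i | IsArgmin c a ((1 / 2 : ℝ) • x + (1 / 2 : ℝ) • y) i} := this ▸ hi
  exact IsArgmin.of_combo (by norm_num) (by norm_num) (by norm_num) hxy hi'

/-- The point z is relatively interior to its own cell: a term that ties for the minimum at z also
ties at y, hence along the whole line, and any other term is strictly larger at z, hence also
slightly beyond z. -/
theorem exists_back_mem_minCell [Finite ι] {x y z : Fin (n + 1) → ℝ}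
    (hz : z ∈ minCell c a x) (hy : y ∈ minCell c a z) :
    ∃ ε : ℝ, 0 < ε ∧ (1 + ε) • z + (-ε) • y ∈ minCell c a x := by
  have hev : ∀ j, ∀ᶠ ε : ℝ in nhdsWithin 0 (Set.Ioi 0), ∀ i, IsArgmin c a x i →
      aff (c i) (a i) ((1 + ε) • z + (-ε) • y) ≤ aff (c j) (a j) ((1 + ε) • z + (-ε) • y) := by
    intro j
    rw [Filter.eventually_all]
    intro i
    by_cases hi : IsArgmin c a x i
    swap
    · exact Filter.Eventually.of_forall fun _ h => absurd h hi
    have hzi := hz i hi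
    have hyi := hy i hzi
    by_cases hj : IsArgmin c a z j
    · have hyj := hy j hj
      refine Filter.Eventually.of_forall fun ε _ => ?_
      rw [aff_combo (by ring), aff_combo (by ring), le_antisymm (hzi j) (hj i),
        le_antisymm (hyi j) (hyj i)]
    · have hlt : aff (c i) (a i) z < aff (c j) (a j) z := by
        refine lt_of_le_of_ne (hzi j) fun h => hj fun k => ?_
        rw [← h]
        exact hzi k
      have hc : ∀ k, Filter.Tendsto (fun ε : ℝ => aff (c k) (a k) ((1 + ε) • z + (-ε) • y))
          (nhds 0) (nhds (aff (c k) (a k) z)) := fun k => by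
        have : Continuous fun ε : ℝ => aff (c k) (a k) ((1 + ε) • z + (-ε) • y) :=
          (continuous_aff _ _).comp (by fun_prop)
        simpa using this.tendsto 0
      exact (((hc i).eventually_lt (hc j) hlt).filter_mono nhdsWithin_le_nhds).mono
        fun ε h _ => h.le
  obtain ⟨ε, h1, h2⟩ := ((Filter.eventually_all.2 hev).and self_mem_nhdsWithin).exists
  exact ⟨ε, h2, fun i hi j => h1 j i hi⟩

/-- Exposed sets are defined by maxima, so the functional is negated. -/
theorem IsFace.of_functional {m : ℕ} {F P : Set (Fin m → ℝ)} (hne : F.Nonempty)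
    (u : Fin m → ℝ) (r : ℝ) (hle : ∀ y ∈ P, r ≤ ∑ l, u l * y l)
    (hF : F = {y | y ∈ P ∧ ∑ l, u l * y l = r}) : IsFace F P := by
  refine ⟨hne, fun _ => ?_⟩
  let φ : (Fin m → ℝ) →L[ℝ] ℝ := ∑ l, (-u l) • ContinuousLinearMap.proj l
  have hφ : ∀ y, φ y = -∑ l, u l * y l := by
    intro y
    simp [φ, Finset.sum_neg_distrib]
  refine ⟨φ, ?_⟩
  subst hF
  obtain ⟨z, hzP, hz⟩ := hne
  ext y
  constructor
  · rintro ⟨hy, h⟩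
    refine ⟨hy, fun z hz => ?_⟩
    rw [hφ, hφ, h]
    exact neg_le_neg (hle z hz)
  · rintro ⟨hy, h⟩
    refine ⟨hy, le_antisymm ?_ (hle y hy)⟩
    have := h z hzP
    rw [hφ, hφ, hz] at this
    linarith

/-- Fix a term i minimal at x. The sum of (term j − term i) over the terms j minimal at x' is
nonnegative on the cell of x, and vanishes exactly where all these j are minimal. Its linear part
exposes the intersection. -/
theorem minCell_inter [Finite ι] [Nonempty ι] {x x' : Fin (n + 1) → ℝ}
    (hne : (minCell c a x ∩ minCell c a x').Nonempty) :
    IsFace (minCell c a x ∩ minCell c a x') (minCell c a x) := by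
  classical
  have := Fintype.ofFinite ι
  obtain ⟨i, hi⟩ := exists_isArgmin c a x
  let s : Finset ι := Finset.univ.filter fun j => IsArgmin c a x' j
  let u : Fin (n + 1) → ℝ := fun l => ∑ j ∈ s, ((a j l : ℝ) - (a i l : ℝ))
  have hu : ∀ y : Fin (n + 1) → ℝ, ∑ l, u l * y l = ∑ j ∈ s, (aff (c j) (a j) y -
      aff (c i) (a i) y) + ∑ j ∈ s, (c i - c j) := by
    intro y
    simp only [u, Finset.sum_mul]
    rw [Finset.sum_comm, ← Finset.sum_add_distrib]
    refine Finset.sum_congr rfl fun j _ => ?_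
    simp only [aff, dot, sub_mul, Finset.sum_sub_distrib]
    simp only [mul_comm]
    ring
  have hnn : ∀ y ∈ minCell c a x, ∀ j ∈ s, 0 ≤ aff (c j) (a j) y - aff (c i) (a i) y :=
    fun y hy j _ => sub_nonneg.2 (hy i hi j)
  refine IsFace.of_functional hne u (∑ j ∈ s, (c i - c j)) ?_ ?_
  · intro y hy
    rw [hu]
    exact le_add_of_nonneg_left (Finset.sum_nonneg (hnn y hy))
  · ext y
    simp only [Set.mem_inter_iff, Set.mem_ofPred_eq, and_congr_right_iff]
    intro hy
    rw [hu, add_eq_right, Finset.sum_eq_zero_iff_of_nonneg (hnn y hy)]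
    constructor
    · intro h j hj
      exact sub_eq_zero.2 (le_antisymm (h j (Finset.mem_filter.1 hj).2 i) (hy i hi j))
    · intro h j hj k
      rw [sub_eq_zero.1 (h j (Finset.mem_filter.2 ⟨Finset.mem_univ j, hj⟩))]
      exact hy i hi k

/-- The minimum is affine on the convex set F, so F lies in the cell of some z in F. A functional
maximal at z cannot drop at a point y of that cell, since z can be moved away from y within the
larger cell, where the functional would grow. -/
theorem minCell_face [Finite ι] [Nonempty ι] {x : Fin (n + 1) → ℝ} {F : Set (Fin (n + 1) → ℝ)}
    (hF : IsFace F (minCell c a x)) : ∃ z, F = minCell c a z := by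
  obtain ⟨φ, hφ⟩ := hF.2 hF.1
  obtain ⟨i, hi⟩ := exists_isArgmin c a x
  have hconv : Convex ℝ F := hF.2.convex (minCell_convex x)
  have hval : ∀ y ∈ F, tropMin c a y = aff (c i) (a i) y := fun y hy => by
    rw [hφ] at hy
    exact (hy.1 i hi).tropMin_eq
  obtain ⟨z, hz, hsub⟩ := exists_subset_minCell (c := c) (a := a) hconv hF.1 fun y hy y' hy' => by
    rw [hval y hy, hval y' hy', hval _ (hconv hy hy' (by norm_num) (by norm_num) (by norm_num)),
      aff_combo (by norm_num)]
  refine ⟨z, hsub.antisymm fun y hy => ?_⟩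
  rw [hφ] at hz ⊢
  refine ⟨fun j hj => hy j (hz.1 j hj), fun y' hy' => (hz.2 y' hy').trans ?_⟩
  obtain ⟨ε, hε, hm⟩ := exists_back_mem_minCell hz.1 hy
  have := hz.2 _ hm
  simp only [map_add, map_smul, smul_eq_mul] at this
  by_contra hcon
  push Not at hcon
  nlinarith [mul_lt_mul_of_pos_left hcon hε]

/-- The complex of the cells `minCell c a x`. -/
def minComplex [Finite ι] [Nonempty ι] (c : ι → ℝ) (a : ι → Fin (n + 1) →₀ ℕ) :
    PolyComplex (n + 1) where
  cells := Set.range (minCell c a)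
  isPolyhedron := by
    rintro _ ⟨x, rfl⟩
    exact minCell_isPolyhedron c a x
  nonempty := by
    rintro _ ⟨x, rfl⟩
    exact ⟨x, mem_minCell_self x⟩
  face_mem := by
    rintro _ ⟨x, rfl⟩ F hF
    obtain ⟨z, rfl⟩ := minCell_face hF
    exact ⟨z, rfl⟩
  inter_face := by
    rintro _ ⟨x, rfl⟩ _ ⟨y, rfl⟩ hne
    refine ⟨minCell_inter hne, ?_⟩
    rw [Set.inter_comm] at hne ⊢
    exact minCell_inter hne

theorem isPolyhedron_convex {m : ℕ} {P : Set (Fin m → ℝ)} (hP : IsPolyhedron P) :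
    Convex ℝ P := by
  obtain ⟨r, A, b, rfl⟩ := hP
  intro x hx y hy α β hα hβ h
  simp only [Set.mem_ofPred_eq] at hx hy ⊢
  rw [Matrix.mulVec_add, Matrix.mulVec_smul, Matrix.mulVec_smul]
  calc α • A.mulVec x + β • A.mulVec y ≤ α • b + β • b :=
        add_le_add (smul_le_smul_of_nonneg_left hx hα) (smul_le_smul_of_nonneg_left hy hβ)
    _ = b := by rw [← add_smul, h, one_smul]

theorem minComplex_isCoarsest [Finite ι] [Nonempty ι] (c : ι → ℝ) (a : ι → Fin (n + 1) →₀ ℕ) :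
    (minComplex c a).IsCoarsest (tropMin c a) := by
  refine ⟨⟨?_, ?_⟩, ?_⟩
  · exact Set.eq_univ_of_forall fun x => ⟨_, ⟨x, rfl⟩, mem_minCell_self x⟩
  · rintro _ ⟨x, rfl⟩
    obtain ⟨i, hi⟩ := exists_isArgmin c a x
    refine ⟨fun l => (a i l : ℝ), c i, fun y hy => ?_⟩
    rw [(hy i hi).tropMin_eq, aff, dot, add_comm]
    simp only [mul_comm]
  · intro S' hS' P hP
    obtain ⟨u, r, hu⟩ := hS'.2 P hP
    have hconv := isPolyhedron_convex (S'.isPolyhedron P hP)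
    obtain ⟨x, -, hx⟩ := exists_subset_minCell (c := c) (a := a) hconv (S'.nonempty P hP)
      fun x hx y hy => by
        rw [hu _ hx, hu _ hy, hu _ (hconv hx hy (by norm_num) (by norm_num) (by norm_num))]
        simp only [Pi.add_apply, Pi.smul_apply, smul_eq_mul, mul_add, Finset.sum_add_distrib,
          mul_left_comm _ (1 / 2 : ℝ), ← Finset.mul_sum]
        ring
    exact ⟨_, ⟨x, rfl⟩, hx⟩

/-- A maximal cell of a coarsest complex is the cell of each of its interior points. -/
theorem maximal_cell_eq_minCell [Finite ι] [Nonempty ι] {S : PolyComplex (n + 1)}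
    (hS : S.IsCoarsest (tropMin c a)) {σ : Set (Fin (n + 1) → ℝ)}
    (hσ : Maximal (fun P => P ∈ S.cells) σ) {w : Fin (n + 1) → ℝ} (hw : w ∈ interior σ) :
    σ = minCell c a w := by
  have h0 := minComplex_isCoarsest c a
  obtain ⟨Q, ⟨x, rfl⟩, hx⟩ := h0.2 S hS.1 σ hσ.1
  obtain ⟨Q', hQ', hsub⟩ := hS.2 _ h0.1 _ ⟨x, rfl⟩
  -- Two coarsest complexes refine each other, so maximality of σ closes the chain of inclusions.
  have heq : σ = minCell c a x := hx.antisymm (hsub.trans (hσ.2 hQ' (hx.trans hsub)))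
  obtain ⟨i, hi⟩ := exists_isArgmin c a x
  -- A sum with one summand, in the form that `IsArgmin.of_affine_sum` takes.
  have hlin : ∀ y ∈ σ, ∑ d ∈ ({()} : Finset Unit), tropMin c a y = aff (c i) (a i) y := by
    intro y hy
    rw [heq] at hy
    simpa using (hy i hi).tropMin_eq
  refine Set.Subset.antisymm (fun y hy j hj => ?_) (fun y hy => ?_)
  · exact IsArgmin.of_affine_sum (κ := fun _ : Unit => ι) {()} (fun _ => c) (fun _ => a) hlin hw hy
      (Finset.mem_singleton_self ()) hj
  · rw [heq]
    have hwx : w ∈ minCell c a x := heq ▸ interior_subset hw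
    exact fun j hj => hy j (hwx j hj)

end Coarsest

/-! ### Upward closed sets of exponents with a given Hilbert function -/

section HilbertFunction

variable {σ : Type*} [Finite σ]

theorem finite_degree_eq (d : ℕ) : {u : σ →₀ ℕ | u.degree = d}.Finite := by
  classical
  have := Fintype.ofFinite σ
  refine (Set.finite_Iic (Finsupp.equivFunOnFinite.symm fun _ : σ => d)).subset fun u hu i => ?_
  rw [← (hu : u.degree = d)]
  exact Finsupp.le_degree i u

theorem eq_of_subset_of_hilbert {U V : Set (σ →₀ ℕ)} (h : U ⊆ V)
    (hc : ∀ d, {u | u ∈ V ∧ u.degree = d}.ncard = {u | u ∈ U ∧ u.degree = d}.ncard) : U = V := by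
  refine h.antisymm fun u hu => ?_
  have := Set.eq_of_subset_of_ncard_le (s := {u' | u' ∈ U ∧ u'.degree = u.degree})
    (t := {u' | u' ∈ V ∧ u'.degree = u.degree}) (fun x hx => ⟨h hx.1, hx.2⟩) (hc _).le
    ((finite_degree_eq u.degree).subset fun x hx => hx.2)
  have h2 : u ∈ {u' | u' ∈ V ∧ u'.degree = u.degree} := ⟨hu, rfl⟩
  rw [← this] at h2
  exact h2.1

/-- Dickson's lemma: the minimal elements form an antichain in a well-quasi-order. -/
theorem exists_minimal_degree_bound (U : Set (σ →₀ ℕ)) :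
    ∃ D, ∀ u, Minimal (· ∈ U) u → u.degree ≤ D := by
  have hfin : {u | Minimal (· ∈ U) u}.Finite :=
    WellQuasiOrderedLE.finite_of_isAntichain (setOfPred_minimal_antichain _)
  obtain ⟨D, hD⟩ := (hfin.image Finsupp.degree).bddAbove
  exact ⟨D, fun u hu => hD ⟨u, hu, rfl⟩⟩

theorem exists_minimal_le {U : Set (σ →₀ ℕ)} {u : σ →₀ ℕ} (hu : u ∈ U) :
    ∃ m ≤ u, Minimal (· ∈ U) m := by
  exact exists_minimal_le_of_wellFoundedLT (· ∈ U) u hu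

/-- The degrees of the minimal elements of all upward closed sets with a given Hilbert function
are bounded. -/
theorem exists_degree_bound_of_hilbert (σ : Type*) [Finite σ] (h : ℕ → ℕ) :
    ∃ D, ∀ U : Set (σ →₀ ℕ), IsUpperSet U → (∀ d, {u | u ∈ U ∧ u.degree = d}.ncard = h d) →
      ∀ u, Minimal (· ∈ U) u → u.degree ≤ D := by
  by_contra! hcon
  choose U hup hcard u hmin hdeg using hcon
  -- Compactness: M is the ultrafilter limit of counterexamples U i that have a minimal element of
  -- degree greater than i. Each degree has finitely many monomials, so M agrees with F-almost every
  -- U i there and inherits the Hilbert function.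
  let F := Filter.hyperfilter ℕ
  let M : Set (σ →₀ ℕ) := {u | ∀ᶠ i in (F : Filter ℕ), u ∈ U i}
  have hagree : ∀ d, ∀ᶠ i in (F : Filter ℕ), ∀ x ∈ {u : σ →₀ ℕ | u.degree = d},
      x ∈ U i ↔ x ∈ M := by
    intro d
    rw [Filter.eventually_all_finite (finite_degree_eq d)]
    intro x _
    by_cases hx : x ∈ M
    · exact (show ∀ᶠ i in (F : Filter ℕ), x ∈ U i from hx).mono fun i hi => iff_of_true hi hx
    · exact (Ultrafilter.eventually_not.2 hx).mono fun i hi => iff_of_false hi hx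
  have hMcard : ∀ d, {u | u ∈ M ∧ u.degree = d}.ncard = h d := by
    intro d
    obtain ⟨i, hi⟩ := (hagree d).exists
    rw [← hcard i d]
    congr 1
    ext x
    exact and_congr_left fun hx => (hi x hx).symm
  obtain ⟨D, hD⟩ := exists_minimal_degree_bound M
  have hlarge : ∀ᶠ i in (F : Filter ℕ), D ≤ i := by
    have := Filter.hyperfilter_le_cofinite (α := ℕ)
    rw [Nat.cofinite_eq_atTop] at this
    exact this (Filter.eventually_ge_atTop D)
  have hall : ∀ᶠ i in (F : Filter ℕ), ∀ d ∈ Set.Iic D, ∀ x ∈ {u : σ →₀ ℕ | u.degree = d},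
      x ∈ U i ↔ x ∈ M :=
    (Filter.eventually_all_finite (Set.finite_Iic D)).2 fun d _ => hagree d
  obtain ⟨i, hi, hDi⟩ := (hall.and hlarge).exists
  -- U i contains the minimal elements of M, and it is upward closed.
  have hsub : M ⊆ U i := by
    intro x hx
    obtain ⟨m, hmx, hm⟩ := exists_minimal_le hx
    exact hup i hmx ((hi _ (hD m hm) m rfl).2 hm.1)
  have heq : M = U i := eq_of_subset_of_hilbert hsub fun d => by rw [hcard, hMcard]
  have h1 := hD (u i) (by rw [heq]; exact hmin i)
  have h2 := hdeg i
  omega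

end HilbertFunction

/-! ### Maximal minors of a matrix over a valued field -/

section Minors

variable {K : Type*} [Field K] {s N n : ℕ}

/-- The maximal minor of `A` with columns in `J`. -/
noncomputable def minor (A : Matrix (Fin s) (Fin N) K) (J : {J : Finset (Fin N) // J.card = s}) :
    K :=
  (A.submatrix id (J.1.orderEmbOfFin J.2)).det

/-- The column sets of the nonzero maximal minors of `A`. -/
abbrev ColBasis (A : Matrix (Fin s) (Fin N) K) : Type :=
  {J : {J : Finset (Fin N) // J.card = s} // minor A J ≠ 0}

namespace ColBasis

variable {A : Matrix (Fin s) (Fin N) K}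

/-- The columns in `J`, in increasing order. -/
def col (J : ColBasis A) : Fin s ↪o Fin N := J.1.1.orderEmbOfFin J.1.2

theorem col_mem (J : ColBasis A) (i : Fin s) : J.col i ∈ J.1.1 :=
  Finset.orderEmbOfFin_mem _ _ i

theorem exists_col_eq (J : ColBasis A) {j : Fin N} (hj : j ∈ J.1.1) : ∃ i, J.col i = j := by
  have := Finset.range_orderEmbOfFin J.1.1 J.1.2
  have hj' : j ∈ Set.range (J.1.1.orderEmbOfFin J.1.2) := by rw [this]; exact hj
  exact hj'

theorem sum_eq_sum_col {M : Type*} [AddCommMonoid M] (J : ColBasis A) (f : Fin N → M) :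
    ∑ j ∈ J.1.1, f j = ∑ i, f (J.col i) := by
  conv_lhs => rw [← Finset.map_orderEmbOfFin_univ J.1.1 J.1.2, Finset.sum_map]
  rfl

/-- The matrix, row equivalent to `A`, that has an identity matrix in the columns of `J`. -/
noncomputable def reduced (J : ColBasis A) : Matrix (Fin s) (Fin N) K :=
  (A.submatrix id J.col)⁻¹ * A

theorem isUnit_det (J : ColBasis A) : IsUnit (A.submatrix id J.col).det :=
  isUnit_iff_ne_zero.2 J.2

theorem submatrix_mul_reduced (J : ColBasis A) : A.submatrix id J.col * J.reduced = A := by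
  rw [reduced, ← Matrix.mul_assoc, Matrix.mul_nonsing_inv _ J.isUnit_det, Matrix.one_mul]

theorem reduced_submatrix (J : ColBasis A) : J.reduced.submatrix id J.col = 1 := by
  have : J.reduced.submatrix id J.col =
      (A.submatrix id J.col)⁻¹ * A.submatrix id J.col := rfl
  rw [this, Matrix.nonsing_inv_mul _ J.isUnit_det]

theorem reduced_apply_col (J : ColBasis A) (i k : Fin s) :
    J.reduced i (J.col k) = if i = k then 1 else 0 := by
  have := congrFun (congrFun J.reduced_submatrix i) k
  rwa [Matrix.one_apply] at this

theorem det_submatrix_eq (J : ColBasis A) (ρ : Fin s → Fin N) :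
    (A.submatrix id ρ).det = minor A J.1 * (J.reduced.submatrix id ρ).det := by
  have : A.submatrix id ρ = A.submatrix id J.col * J.reduced.submatrix id ρ := by
    conv_lhs => rw [← J.submatrix_mul_reduced]
    rfl
  rw [this, Matrix.det_mul]
  rfl

/-- The column rank equals the row rank s, so a basis of the column space chosen among the columns
gives a nonzero minor. -/
theorem nonempty (hA : LinearIndependent K A.row) : Nonempty (ColBasis A) := by
  obtain ⟨κ, g, hg, hspan, hli⟩ := exists_linearIndependent' K A.col
  have := Finite.of_injective g hg
  have := Fintype.ofFinite κ
  have hcard : Fintype.card κ = s := by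
    have h1 := linearIndependent_iff_card_eq_finrank_span.1 hli
    rw [Set.finrank, hspan, ← Matrix.rank_eq_finrank_span_cols, hA.rank_matrix] at h1
    simpa using h1
  classical
  let J : Finset (Fin N) := Finset.univ.image g
  have hJ : J.card = s := by rw [Finset.card_image_of_injective _ hg, Finset.card_univ, hcard]
  refine ⟨⟨J, hJ⟩, ?_⟩
  have hmem : ∀ i, ∃ k, g k = J.orderEmbOfFin hJ i := fun i => by
    obtain ⟨k, -, h⟩ := Finset.mem_image.1 (J.orderEmbOfFin_mem hJ i)
    exact ⟨k, h⟩
  choose f hf using hmem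
  have hfinj : Function.Injective f := fun i i' h => by
    apply (J.orderEmbOfFin hJ).injective
    rw [← hf, ← hf, h]
  have hli2 : LinearIndependent K (A.submatrix id (J.orderEmbOfFin hJ)).col := by
    have h2 := hli.comp f hfinj
    convert! h2 using 1
    ext i k
    change A k (J.orderEmbOfFin hJ i) = A k (g (f i))
    rw [hf]
  have h3 := Matrix.linearIndependent_cols_iff_isUnit.1 hli2
  exact ((Matrix.isUnit_iff_isUnit_det _).1 h3).ne_zero

end ColBasis

variable (v : AddValuation K (WithTop ℝ))

theorem v_sign_mul (π : Equiv.Perm (Fin s)) (x : K) :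
    v (((Equiv.Perm.sign π : ℤˣ) : ℤ) * x) = v x := by
  rcases Int.units_eq_one_or (Equiv.Perm.sign π) with h | h <;> simp [h, v.map_neg]

/-- Reordering the columns changes the determinant only by a sign, which the valuation ignores. -/
theorem v_det_submatrix (A : Matrix (Fin s) (Fin N) K) (ρ : Fin s → Fin N)
    (hρ : Function.Injective ρ) (J : {J : Finset (Fin N) // J.card = s})
    (hJ : ∀ i, ρ i ∈ J.1) : v (A.submatrix id ρ).det = v (minor A J) := by
  have hmem : ∀ i, ∃ k, J.1.orderEmbOfFin J.2 k = ρ i := fun i => by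
    have : ρ i ∈ Set.range (J.1.orderEmbOfFin J.2) := by
      rw [Finset.range_orderEmbOfFin]; exact hJ i
    exact this
  choose f hf using hmem
  have hfinj : Function.Injective f := fun i i' h => hρ (by rw [← hf, ← hf, h])
  let π : Equiv.Perm (Fin s) := Equiv.ofBijective f (Finite.injective_iff_bijective.1 hfinj)
  have : A.submatrix id ρ = (A.submatrix id (J.1.orderEmbOfFin J.2)).submatrix id π := by
    ext i k
    simp [π, hf]
  rw [this, Matrix.det_permute', v_sign_mul]
  rfl

theorem le_v_prod {ι : Type*} (S : Finset ι) (f : ι → K) (α : ι → ℝ)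
    (h : ∀ i ∈ S, (α i : WithTop ℝ) ≤ v (f i)) :
    ((∑ i ∈ S, α i : ℝ) : WithTop ℝ) ≤ v (∏ i ∈ S, f i) := by
  classical
  induction S using Finset.induction_on with
  | empty => simp
  | insert a S ha ih =>
    rw [Finset.sum_insert ha, Finset.prod_insert ha, v.map_mul, WithTop.coe_add]
    exact add_le_add (h a (Finset.mem_insert_self _ _))
      (ih fun i hi => h i (Finset.mem_insert_of_mem hi))

theorem lt_v_prod {ι : Type*} (S : Finset ι) (f : ι → K) (α : ι → ℝ)
    (h : ∀ i ∈ S, (α i : WithTop ℝ) ≤ v (f i)) {k : ι} (hk : k ∈ S)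
    (hlt : (α k : WithTop ℝ) < v (f k)) :
    ((∑ i ∈ S, α i : ℝ) : WithTop ℝ) < v (∏ i ∈ S, f i) := by
  classical
  rw [← Finset.add_sum_erase S α hk, ← Finset.mul_prod_erase S f hk, v.map_mul, WithTop.coe_add]
  exact WithTop.add_lt_add_of_lt_of_le WithTop.coe_ne_top hlt
    (le_v_prod v _ f α fun i hi => h i (Finset.mem_of_mem_erase hi))

/-- The Leibniz expansion bounds the valuation of a determinant. -/
theorem lt_v_det (C : Matrix (Fin s) (Fin s) K) (α β : Fin s → ℝ)
    (h : ∀ i j, ((α i - β j : ℝ) : WithTop ℝ) ≤ v (C i j)) (k : Fin s)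
    (hk : ∀ i, ((α i - β k : ℝ) : WithTop ℝ) < v (C i k)) :
    ((∑ i, α i - ∑ j, β j : ℝ) : WithTop ℝ) < v C.det := by
  rw [Matrix.det_apply']
  refine v.map_lt_sum WithTop.coe_ne_top fun π _ => ?_
  rw [v_sign_mul, ← Equiv.sum_comp π α, ← Finset.sum_sub_distrib]
  exact lt_v_prod v _ _ _ (fun i _ => h _ _) (Finset.mem_univ k) (hk _)

/-- The valuation of a nonzero minor. -/
noncomputable def minorVal (A : Matrix (Fin s) (Fin N) K) (J : ColBasis A) : ℝ :=
  val v (minor A J.1)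

/-- The exponent of the product of the monomials in `J`. -/
noncomputable def minorExp (A : Matrix (Fin s) (Fin N) K) (ε : Fin N → Fin (n + 1) →₀ ℕ) (J : ColBasis A) :
    Fin (n + 1) →₀ ℕ :=
  ∑ j ∈ J.1.1, ε j

variable {v} {A : Matrix (Fin s) (Fin N) K} {ε : Fin N → Fin (n + 1) →₀ ℕ}
  {y : Fin (n + 1) → ℝ} {J : ColBasis A}

theorem dot_minorExp (y : Fin (n + 1) → ℝ) (J : ColBasis A) :
    dot y (minorExp A ε J) = ∑ i, dot y (ε (J.col i)) := by
  rw [minorExp, dot_sum_right, J.sum_eq_sum_col]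

theorem coe_minorVal (J : ColBasis A) : ((minorVal v A J : ℝ) : WithTop ℝ) = v (minor A J.1) :=
  coe_val v J.2

/-- Exchanging a column. -/
theorem exists_exchange (v : AddValuation K (WithTop ℝ)) (J : ColBasis A) (i : Fin s) {j : Fin N}
    (hj : j ∉ J.1.1) (hB : J.reduced i j ≠ 0) : ∃ J' : ColBasis A, j ∈ J'.1.1 ∧
      (∀ ε : Fin N → Fin (n + 1) →₀ ℕ,
        minorExp A ε J' + ε (J.col i) = minorExp A ε J + ε j) ∧
      ((minorVal v A J' : ℝ) : WithTop ℝ) = minorVal v A J + v (J.reduced i j) := by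
  classical
  have hcard : (insert j (J.1.1.erase (J.col i))).card = s := by
    rw [Finset.card_insert_of_notMem fun h => hj (Finset.mem_of_mem_erase h),
      Finset.card_erase_of_mem (J.col_mem i), J.1.2]
    have := i.2
    omega
  let J' : {J : Finset (Fin N) // J.card = s} := ⟨_, hcard⟩
  let ρ : Fin s → Fin N := Function.update J.col i j
  have hρ : Function.Injective ρ := by
    intro k l h
    simp only [ρ, Function.update_apply] at h
    split_ifs at h with h1 h2 h2
    · rw [h1, h2]
    · exact absurd (h ▸ J.col_mem l) hj
    · exact absurd (h ▸ J.col_mem k) hj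
    · exact J.col.injective h
  have hρJ : ∀ k, ρ k ∈ J'.1 := by
    intro k
    simp only [ρ, J', Function.update_apply]
    split_ifs with h1
    · exact Finset.mem_insert_self _ _
    · exact Finset.mem_insert_of_mem (Finset.mem_erase.2 ⟨fun h => h1 (J.col.injective h),
        J.col_mem k⟩)
  -- In these columns the reduced matrix is the identity with its i-th column replaced; Cramer's
  -- rule evaluates the determinant.
  have hdet : (J.reduced.submatrix id ρ).det = J.reduced i j := by
    have : J.reduced.submatrix id ρ =
        (1 : Matrix (Fin s) (Fin s) K).updateCol i (fun k => J.reduced k j) := by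
      ext k l
      simp only [Matrix.submatrix_apply, id, ρ, Matrix.updateCol_apply, Function.update_apply]
      split_ifs with h1
      · rfl
      · rw [J.reduced_apply_col, Matrix.one_apply]
    rw [this, ← Matrix.cramer_apply, Matrix.cramer_one]
    rfl
  have hv : v (minor A J') = v (minor A J.1) + v (J.reduced i j) := by
    rw [← v_det_submatrix v A ρ hρ J' hρJ, J.det_submatrix_eq ρ, v.map_mul, hdet]
  have hne : minor A J' ≠ 0 := by
    rw [← v.ne_top_iff, hv, WithTop.add_ne_top]
    exact ⟨v.ne_top_iff.2 J.2, v.ne_top_iff.2 hB⟩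
  refine ⟨⟨J', hne⟩, Finset.mem_insert_self _ _, fun ε => ?_, ?_⟩
  · simp only [minorExp, J']
    rw [Finset.sum_insert fun h => hj (Finset.mem_of_mem_erase h),
      ← Finset.sum_erase_add _ _ (J.col_mem i)]
    abel
  · rw [coe_minorVal, coe_minorVal, ← hv]

/-- The exchange of `J.col i` for j adds the valuation of the entry to that of the minor, and the
new basis cannot have smaller weight than J. -/
theorem IsArgmin.le_reduced (hJ : IsArgmin (minorVal v A) (minorExp A ε) y J) (i : Fin s)
    (j : Fin N) : ((dot y (ε (J.col i)) - dot y (ε j) : ℝ) : WithTop ℝ) ≤ v (J.reduced i j) := by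
  by_cases hj : j ∈ J.1.1
  · obtain ⟨k, rfl⟩ := J.exists_col_eq hj
    rw [J.reduced_apply_col]
    split_ifs with h
    · simp [h]
    · simp
  by_cases hB : J.reduced i j = 0
  · simp [hB]
  obtain ⟨J', -, h1, h2⟩ := exists_exchange v J i hj hB
  rw [← coe_val v hB] at h2 ⊢
  rw [← WithTop.coe_add, WithTop.coe_inj] at h2
  rw [WithTop.coe_le_coe]
  have h3 := hJ J'
  have h4 := congrArg (dot y) (h1 ε)
  rw [dot_add_right, dot_add_right] at h4
  simp only [aff] at h3
  linarith

/-- If an entry of the reduced matrix has the least possible valuation, then the corresponding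
exchange leads to another minimal minor. -/
theorem IsArgmin.exists_isArgmin_exchange (hJ : IsArgmin (minorVal v A) (minorExp A ε) y J)
    {i : Fin s} {j : Fin N} (hj : j ∉ J.1.1)
    (hB : ¬ ((dot y (ε (J.col i)) - dot y (ε j) : ℝ) : WithTop ℝ) < v (J.reduced i j)) :
    ∃ J' : ColBasis A, IsArgmin (minorVal v A) (minorExp A ε) y J' ∧ j ∈ J'.1.1 ∧
      minorExp A ε J' + ε (J.col i) = minorExp A ε J + ε j := by
  have heq := le_antisymm (hJ.le_reduced i j) (not_lt.1 hB)
  have hB0 : J.reduced i j ≠ 0 := by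
    rw [← v.ne_top_iff, ← heq]
    exact WithTop.coe_ne_top
  obtain ⟨J', h0, h1, h2⟩ := exists_exchange v J i hj hB0
  refine ⟨J', fun J'' => ?_, h0, h1 ε⟩
  rw [← heq, ← WithTop.coe_add, WithTop.coe_inj] at h2
  have h4 := congrArg (dot y) (h1 ε)
  rw [dot_add_right, dot_add_right] at h4
  have h3 := hJ J''
  simp only [aff] at h3 ⊢
  linarith

/-- A different basis J' uses a column outside J. Every Leibniz term of the reduced matrix in the
columns J' has a factor from that column, so the estimate is strict for the determinant, which is
the quotient of the two minors. -/
theorem lt_of_lt_reduced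
    (hJ : ∀ i j, ((dot y (ε (J.col i)) - dot y (ε j) : ℝ) : WithTop ℝ) ≤ v (J.reduced i j))
    (hlt : ∀ i, ∀ j ∉ J.1.1,
      ((dot y (ε (J.col i)) - dot y (ε j) : ℝ) : WithTop ℝ) < v (J.reduced i j))
    {J' : ColBasis A} (hne : J' ≠ J) :
    aff (minorVal v A J) (minorExp A ε J) y < aff (minorVal v A J') (minorExp A ε J') y := by
  obtain ⟨j, hj', hj⟩ : ∃ j ∈ J'.1.1, j ∉ J.1.1 := by
    by_contra! hcon
    exact hne (Subtype.ext (Subtype.ext (Finset.eq_of_subset_of_card_le hcon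
      (by rw [J.1.2, J'.1.2]))))
  obtain ⟨k, rfl⟩ := J'.exists_col_eq hj'
  have h1 := lt_v_det v (J.reduced.submatrix id J'.col) (fun i => dot y (ε (J.col i)))
    (fun j => dot y (ε (J'.col j))) (fun i j => hJ _ _) k (fun i => hlt i _ hj)
  have h2 := J.det_submatrix_eq J'.col
  have h3 : minor A J'.1 = (A.submatrix id J'.col).det := rfl
  rw [← h3] at h2
  have hdet : (J.reduced.submatrix id J'.col).det ≠ 0 := fun h => J'.2 (by rw [h2, h, mul_zero])
  have h4 := congrArg v h2
  rw [v.map_mul, ← coe_minorVal, ← coe_minorVal, ← coe_val v hdet, ← WithTop.coe_add,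
    WithTop.coe_inj] at h4
  rw [← coe_val v hdet, WithTop.coe_lt_coe] at h1
  simp only [aff, dot_minorExp, h4]
  linarith

/-- Equality would give by exchange a minimal basis with the same exponent. The exchanged monomials
would then coincide, although only one of them lies in J. -/
theorem IsArgmin.lt_reduced_of_exp_eq (hε : Function.Injective ε)
    (hJ : IsArgmin (minorVal v A) (minorExp A ε) y J)
    (hexp : ∀ J', IsArgmin (minorVal v A) (minorExp A ε) y J' →
      minorExp A ε J' = minorExp A ε J) (i : Fin s) {j : Fin N} (hj : j ∉ J.1.1) :
    ((dot y (ε (J.col i)) - dot y (ε j) : ℝ) : WithTop ℝ) < v (J.reduced i j) := by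
  by_contra hcon
  obtain ⟨J', h1, -, h2⟩ := hJ.exists_isArgmin_exchange hj hcon
  rw [hexp J' h1] at h2
  exact hj (hε (add_left_cancel h2) ▸ J.col_mem i)

/-- If all minimal minors have the same exponent, then there is only one minimal minor. -/
theorem IsArgmin.lt_of_exp_eq (hε : Function.Injective ε)
    (hJ : IsArgmin (minorVal v A) (minorExp A ε) y J)
    (hexp : ∀ J', IsArgmin (minorVal v A) (minorExp A ε) y J' →
      minorExp A ε J' = minorExp A ε J) {J' : ColBasis A} (hne : J' ≠ J) :
    aff (minorVal v A J) (minorExp A ε J) y < aff (minorVal v A J') (minorExp A ε J') y :=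
  lt_of_lt_reduced hJ.le_reduced (fun i _ hj => hJ.lt_reduced_of_exp_eq hε hexp i hj) hne

end Minors

/-! ### Polynomials with a dominant monomial -/

section Dominant

variable {K : Type*} [Field K] {v : AddValuation K (WithTop ℝ)} {n : ℕ} {y : Fin (n + 1) → ℝ}

/-- All terms of `f` have weight at least `r` at `y`. -/
def WeightGE (v : AddValuation K (WithTop ℝ)) (y : Fin (n + 1) → ℝ) (r : ℝ)
    (f : MvPolynomial (Fin (n + 1)) K) : Prop :=
  ∀ u, ((r - dot y u : ℝ) : WithTop ℝ) ≤ v (coeff u f)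

/-- All terms of `f` have weight greater than `r` at `y`. -/
def WeightGT (v : AddValuation K (WithTop ℝ)) (y : Fin (n + 1) → ℝ) (r : ℝ)
    (f : MvPolynomial (Fin (n + 1)) K) : Prop :=
  ∀ u, ((r - dot y u : ℝ) : WithTop ℝ) < v (coeff u f)

/-- One monomial of `f` is the only one of weight `r` at `y`, and all others have greater weight. -/
def HasDominant (v : AddValuation K (WithTop ℝ)) (y : Fin (n + 1) → ℝ) (r : ℝ)
    (f : MvPolynomial (Fin (n + 1)) K) : Prop :=
  ∃ (a : Fin (n + 1) →₀ ℕ) (c : K) (h : MvPolynomial (Fin (n + 1)) K),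
    f = monomial a c + h ∧ v c = ((r - dot y a : ℝ) : WithTop ℝ) ∧ WeightGT v y r h

theorem WeightGE.add {r : ℝ} {f g : MvPolynomial (Fin (n + 1)) K} (hf : WeightGE v y r f)
    (hg : WeightGE v y r g) : WeightGE v y r (f + g) := fun u => by
  rw [coeff_add]
  exact v.map_le_add (hf u) (hg u)

theorem WeightGT.add {r : ℝ} {f g : MvPolynomial (Fin (n + 1)) K} (hf : WeightGT v y r f)
    (hg : WeightGT v y r g) : WeightGT v y r (f + g) := fun u => by
  rw [coeff_add]
  exact v.map_lt_add (hf u) (hg u)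

theorem WeightGT.zero {r : ℝ} : WeightGT v y r (0 : MvPolynomial (Fin (n + 1)) K) := fun u => by
  rw [coeff_zero, v.map_zero]
  exact WithTop.coe_lt_top _

theorem WeightGT.sum {ι : Type*} {S : Finset ι} {r : ℝ} {f : ι → MvPolynomial (Fin (n + 1)) K}
    (hf : ∀ i ∈ S, WeightGT v y r (f i)) : WeightGT v y r (∑ i ∈ S, f i) := fun u => by
  rw [coeff_sum]
  exact v.map_lt_sum WithTop.coe_ne_top fun i hi => hf i hi u

theorem WeightGT.mul {r r' : ℝ} {f g : MvPolynomial (Fin (n + 1)) K} (hf : WeightGE v y r f)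
    (hg : WeightGT v y r' g) : WeightGT v y (r + r') (f * g) := fun u => by
  rw [coeff_mul]
  refine v.map_lt_sum WithTop.coe_ne_top fun p hp => ?_
  rw [v.map_mul, ← Finset.HasAntidiagonal.mem_antidiagonal.1 hp, dot_add_right,
    show r + r' - (dot y p.1 + dot y p.2) = (r - dot y p.1) + (r' - dot y p.2) by ring,
    WithTop.coe_add]
  exact WithTop.add_lt_add_of_le_of_lt WithTop.coe_ne_top (hf _) (hg _)

theorem WeightGE.monomial {a : Fin (n + 1) →₀ ℕ} {c : K} {r : ℝ}
    (h : ((r - dot y a : ℝ) : WithTop ℝ) ≤ v c) : WeightGE v y r (monomial a c) := fun u => by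
  classical
  rw [coeff_monomial]
  split_ifs with hu
  · rwa [← hu]
  · simp

theorem WeightGT.monomial {a : Fin (n + 1) →₀ ℕ} {c : K} {r : ℝ}
    (h : ((r - dot y a : ℝ) : WithTop ℝ) < v c) : WeightGT v y r (monomial a c) := fun u => by
  classical
  rw [coeff_monomial]
  split_ifs with hu
  · rwa [← hu]
  · rw [v.map_zero]
    exact WithTop.coe_lt_top _

theorem HasDominant.one : HasDominant v y 0 (1 : MvPolynomial (Fin (n + 1)) K) :=
  ⟨0, 1, 0, by simp, by simp [dot_zero_right], WeightGT.zero⟩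

theorem HasDominant.mul {r r' : ℝ} {f g : MvPolynomial (Fin (n + 1)) K}
    (hf : HasDominant v y r f) (hg : HasDominant v y r' g) : HasDominant v y (r + r') (f * g) := by
  obtain ⟨a, c, h, rfl, hc, hh⟩ := hf
  obtain ⟨a', c', h', rfl, hc', hh'⟩ := hg
  have h1 : WeightGE v y r (MvPolynomial.monomial a c) := WeightGE.monomial hc.ge
  have h2 : WeightGE v y r' (MvPolynomial.monomial a' c' + h') :=
    (WeightGE.monomial hc'.ge).add fun u => (hh' u).le
  refine ⟨a + a', c * c', MvPolynomial.monomial a c * h' +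
    (MvPolynomial.monomial a' c' + h') * h, ?_, ?_, (WeightGT.mul h1 hh').add ?_⟩
  · rw [← monomial_mul]
    ring
  · rw [v.map_mul, hc, hc', ← WithTop.coe_add, dot_add_right]
    congr 1
    ring
  · rw [add_comm r]
    exact WeightGT.mul h2 hh

theorem HasDominant.prod {ι : Type*} {S : Finset ι} {r : ι → ℝ}
    {f : ι → MvPolynomial (Fin (n + 1)) K} (h : ∀ i ∈ S, HasDominant v y (r i) (f i)) :
    HasDominant v y (∑ i ∈ S, r i) (∏ i ∈ S, f i) := by
  classical
  induction S using Finset.induction_on with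
  | empty => exact HasDominant.one
  | insert a S ha ih =>
    rw [Finset.sum_insert ha, Finset.prod_insert ha]
    exact (h a (Finset.mem_insert_self _ _)).mul
      (ih fun i hi => h i (Finset.mem_insert_of_mem hi))

/-- If all terms of `f` have weight at least `r`, and one has weight `r`, then `trop(f) = r`. -/
theorem trop_eq {r : ℝ} {f : MvPolynomial (Fin (n + 1)) K} (h : WeightGE v y r f)
    {u : Fin (n + 1) →₀ ℕ} (hu : v (coeff u f) = ((r - dot y u : ℝ) : WithTop ℝ)) :
    trop v f y = r := by
  have hu0 : coeff u f ≠ 0 := by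
    rw [← v.ne_top_iff, hu]
    exact WithTop.coe_ne_top
  have hle : ∀ u' : {u' // u' ∈ f.support}, r ≤ val v (coeff u'.1 f) + dot y u'.1 := fun u' => by
    have := h u'.1
    rw [← coe_val v (mem_support_iff.1 u'.2), WithTop.coe_le_coe] at this
    linarith
  have : Nonempty {u' // u' ∈ f.support} := ⟨⟨u, mem_support_iff.2 hu0⟩⟩
  refine le_antisymm ?_ (le_ciInf hle)
  have h1 : trop v f y ≤ val v (coeff u f) + dot y u :=
    ciInf_le (Set.finite_range _).bddBelow (⟨u, mem_support_iff.2 hu0⟩ : {u' // u' ∈ f.support})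
  rw [← coe_val v hu0, WithTop.coe_inj] at hu
  linarith

theorem HasDominant.ne_zero_and_trop_eq {r : ℝ} {f : MvPolynomial (Fin (n + 1)) K}
    (hf : HasDominant v y r f) : f ≠ 0 ∧ trop v f y = r := by
  obtain ⟨a, c, h, rfl, hc, hh⟩ := hf
  have hv : v (coeff a (MvPolynomial.monomial a c + h)) = ((r - dot y a : ℝ) : WithTop ℝ) := by
    rw [coeff_add, coeff_monomial, if_pos rfl, ← hc]
    exact v.map_add_eq_of_lt_left (hc ▸ hh a)
  refine ⟨fun h0 => ?_, trop_eq ((WeightGE.monomial hc.ge).add fun u => (hh u).le) hv⟩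
  rw [h0, coeff_zero, v.map_zero] at hv
  exact WithTop.coe_ne_top hv.symm

theorem trop_eq_tropMin (f : MvPolynomial (Fin (n + 1)) K) :
    trop v f = tropMin (fun u : {u // u ∈ f.support} => val v (coeff u.1 f)) (fun u => u.1) := rfl

end Dominant

/-! ### Generic points -/

section Generic

variable {n : ℕ}

/-- If the two functions agreed on a nonempty open set, their slopes would be equal. -/
theorem dense_aff_ne {c c' : ℝ} {u u' : Fin (n + 1) →₀ ℕ} (h : u ≠ u') :
    Dense {y : Fin (n + 1) → ℝ | aff c u y ≠ aff c' u' y} := by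
  have : {y : Fin (n + 1) → ℝ | aff c u y ≠ aff c' u' y} =
    {y : Fin (n + 1) → ℝ | aff c u y = aff c' u' y}ᶜ := rfl
  rw [this, ← interior_eq_empty_iff_dense_compl, Set.eq_empty_iff_forall_notMem]
  intro w hw
  have hmem := interior_subset hw
  exact h (aff_eq_of_le_of_interior hw (fun x hx => le_of_eq hx) hmem).2

theorem isOpen_aff_ne {c c' : ℝ} {u u' : Fin (n + 1) →₀ ℕ} :
    IsOpen {y : Fin (n + 1) → ℝ | aff c u y ≠ aff c' u' y} :=
  isOpen_ne_fun (continuous_aff _ _) (continuous_aff _ _)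

variable {K : Type*} [Field K] (v : AddValuation K (WithTop ℝ)) {s N : ℕ → ℕ}
  (A : ∀ d, Matrix (Fin (s d)) (Fin (N d)) K) (ε : ∀ d, Fin (N d) → Fin (n + 1) →₀ ℕ)

/-- The points at which no two minors with different exponents have the same weight. -/
def genericSet : Set (Fin (n + 1) → ℝ) :=
  {y | ∀ d, ∀ J J' : ColBasis (A d), minorExp (A d) (ε d) J ≠ minorExp (A d) (ε d) J' →
    aff (minorVal v (A d) J) (minorExp (A d) (ε d) J) y ≠
      aff (minorVal v (A d) J') (minorExp (A d) (ε d) J') y}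

/-- All degrees are treated at once, so this is a countable intersection of dense open sets, and
Baire's theorem applies. -/
theorem dense_genericSet : Dense (genericSet v A ε) := by
  have : genericSet v A ε = ⋂ p : {p : Σ d, ColBasis (A d) × ColBasis (A d) //
      minorExp (A p.1) (ε p.1) p.2.1 ≠ minorExp (A p.1) (ε p.1) p.2.2},
      {y | aff (minorVal v (A p.1.1) p.1.2.1) (minorExp (A p.1.1) (ε p.1.1) p.1.2.1) y ≠
        aff (minorVal v (A p.1.1) p.1.2.2) (minorExp (A p.1.1) (ε p.1.1) p.1.2.2) y} := by
    ext y
    rw [Set.mem_iInter]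
    exact ⟨fun h p => h p.1.1 _ _ p.2, fun h d J J' hne => h ⟨⟨d, J, J'⟩, hne⟩⟩
  rw [this]
  exact dense_iInter_of_isOpen (fun p => isOpen_aff_ne) (fun p => dense_aff_ne p.2)

variable {v A ε}

theorem exp_eq_of_mem_genericSet {y : Fin (n + 1) → ℝ} (hy : y ∈ genericSet v A ε) {d : ℕ}
    {J J' : ColBasis (A d)} (hJ : IsArgmin (minorVal v (A d)) (minorExp (A d) (ε d)) y J)
    (hJ' : IsArgmin (minorVal v (A d)) (minorExp (A d) (ε d)) y J') :
    minorExp (A d) (ε d) J' = minorExp (A d) (ε d) J := by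
  by_contra hne
  exact hy d J' J hne (le_antisymm (hJ' J) (hJ J'))

end Generic

/-! ### The tropicalization of the Plücker polynomials -/

section TropPluecker

variable {K : Type*} [Field K] {v : AddValuation K (WithTop ℝ)} {n : ℕ}
  {I : Ideal (MvPolynomial (Fin (n + 1)) K)}

/-- The matrix of the coefficients of a basis of the degree `d` part of `I`. -/
noncomputable def coeffMatrix {d s N : ℕ} (b : Module.Basis (Fin s) K (degreePart I d)) (e : Fin N ≃ Mon n d) :
    Matrix (Fin s) (Fin N) K :=
  Matrix.of fun i j => coeff (e j).1 (b i).1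

/-- The exponent of the `j`-th monomial. -/
def expOf {d N : ℕ} (e : Fin N ≃ Mon n d) (j : Fin N) : Fin (n + 1) →₀ ℕ := (e j).1

theorem expOf_injective {d N : ℕ} (e : Fin N ≃ Mon n d) : Function.Injective (expOf e) :=
  Subtype.val_injective.comp e.injective

theorem degree_expOf {d N : ℕ} (e : Fin N ≃ Mon n d) (j : Fin N) : (expOf e j).degree = d :=
  (e j).2

theorem exists_expOf {d N : ℕ} (e : Fin N ≃ Mon n d) {u : Fin (n + 1) →₀ ℕ} (hu : u.degree = d) :
    ∃ j, expOf e j = u :=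
  ⟨e.symm ⟨u, hu⟩, by simp [expOf]⟩

theorem coeff_eq_zero_of_mem_degreePart {d : ℕ} {f : MvPolynomial (Fin (n + 1)) K}
    (hf : f ∈ degreePart I d) {u : Fin (n + 1) →₀ ℕ} (hu : u.degree ≠ d) : coeff u f = 0 := by
  have h : f.IsHomogeneous d := hf.2
  exact h.coeff_eq_zero hu

theorem linearIndependent_coeffMatrix {d s N : ℕ}
    (b : Module.Basis (Fin s) K (degreePart I d)) (e : Fin N ≃ Mon n d) :
    LinearIndependent K (coeffMatrix b e).row := by
  rw [Fintype.linearIndependent_iff]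
  intro x hx
  have hsum : ∑ i, x i • b i = 0 := by
    apply Subtype.ext
    ext u
    by_cases hu : u.degree = d
    · obtain ⟨j, rfl⟩ := exists_expOf e hu
      have := congrFun hx j
      simpa [coeffMatrix, coeff_sum, expOf, Matrix.row] using this
    · rw [coeff_eq_zero_of_mem_degreePart (∑ i, x i • b i).2 hu]
      simp
  exact Fintype.linearIndependent_iff.1 b.linearIndependent x hsum

instance {d s N : ℕ} (b : Module.Basis (Fin s) K (degreePart I d)) (e : Fin N ≃ Mon n d) :
    Nonempty (ColBasis (coeffMatrix b e)) :=
  ColBasis.nonempty (linearIndependent_coeffMatrix b e)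

/-- Another J' may contribute to the same monomial, but its coefficient has larger valuation and
cannot cancel the dominant one. -/
theorem hasDominant_plueckerPoly {d s N : ℕ} (b : Module.Basis (Fin s) K (degreePart I d))
    (e : Fin N ≃ Mon n d) {y : Fin (n + 1) → ℝ} {J : ColBasis (coeffMatrix b e)}
    (hJ : ∀ J', J' ≠ J → aff (minorVal v _ J) (minorExp _ (expOf e) J) y <
      aff (minorVal v _ J') (minorExp _ (expOf e) J') y) :
    HasDominant v y (aff (minorVal v _ J) (minorExp _ (expOf e) J) y) (plueckerPoly b e) := by
  classical
  have hterm : ∀ J : {J : Finset (Fin N) // J.card = s},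
      C ((coeffMatrix b e).submatrix id (J.1.orderEmbOfFin J.2)).det *
        ∏ j ∈ J.1, monomial (e j).1 (1 : K) =
      monomial (∑ j ∈ J.1, expOf e j) (minor (coeffMatrix b e) J) := by
    intro J
    rw [← monomial_sum_one]
    exact C_mul_monomial.trans (by rw [mul_one]; rfl)
  refine ⟨minorExp _ (expOf e) J, minor (coeffMatrix b e) J.1, ∑ J' ∈ Finset.univ.erase J.1,
    monomial (∑ j ∈ J'.1, expOf e j) (minor (coeffMatrix b e) J'), ?_, ?_, ?_⟩
  · rw [minorExp, Finset.add_sum_erase Finset.univ (fun J' : {J : Finset (Fin N) // J.card = s} =>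
      monomial (∑ j ∈ J'.1, expOf e j) (minor (coeffMatrix b e) J')) (Finset.mem_univ _)]
    exact Finset.sum_congr rfl fun J' _ => hterm J'
  · rw [← coe_minorVal, aff, add_sub_cancel_right]
  · refine WeightGT.sum fun J' hJ' => ?_
    by_cases h0 : minor (coeffMatrix b e) J' = 0
    · rw [h0, monomial_zero]
      exact WeightGT.zero
    · have hne : (⟨J', h0⟩ : ColBasis (coeffMatrix b e)) ≠ J := by
        rintro rfl
        simp at hJ'
      have h1 := hJ _ hne
      refine WeightGT.monomial ?_
      rw [← coe_val v h0, WithTop.coe_lt_coe]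
      have h2 : aff (minorVal v _ ⟨J', h0⟩) (minorExp _ (expOf e) ⟨J', h0⟩) y =
        val v (minor (coeffMatrix b e) J') + dot y (∑ j ∈ J'.1, expOf e j) := rfl
      linarith

variable {s N : ℕ → ℕ} (t : Splitting v) (b : ∀ d, Module.Basis (Fin (s d)) K (degreePart I d))
  (e : ∀ d, Fin (N d) ≃ Mon n d)

/-- The points at which no two Plücker coordinates with different exponents have the same weight. -/
def genericPoints (v : AddValuation K (WithTop ℝ))
    (b : ∀ d, Module.Basis (Fin (s d)) K (degreePart I d)) (e : ∀ d, Fin (N d) ≃ Mon n d) :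
    Set (Fin (n + 1) → ℝ) :=
  genericSet v (fun d => coeffMatrix (b d) (e d)) (fun d => expOf (e d))

/-- The minimum of the weights of the Plücker coordinates in degree `d`. -/
noncomputable def tropPluecker (v : AddValuation K (WithTop ℝ)) {d s N : ℕ}
    (b : Module.Basis (Fin s) K (degreePart I d)) (e : Fin N ≃ Mon n d) : (Fin (n + 1) → ℝ) → ℝ :=
  tropMin (minorVal v (coeffMatrix b e)) (minorExp (coeffMatrix b e) (expOf e))

/-- The columns `J` have the minimal weight at `y` among the bases of the columns. -/
def IsMinBasis (v : AddValuation K (WithTop ℝ)) {d s N : ℕ}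
    (b : Module.Basis (Fin s) K (degreePart I d)) (e : Fin N ≃ Mon n d) (y : Fin (n + 1) → ℝ)
    (J : ColBasis (coeffMatrix b e)) : Prop :=
  IsArgmin (minorVal v (coeffMatrix b e)) (minorExp (coeffMatrix b e) (expOf e)) y J

/-- At a generic point all minimal bases of one degree share their exponent, hence there is only
one. Dominant monomials multiply. -/
theorem hasDominant_groebnerPoly {y : Fin (n + 1) → ℝ} (hy : y ∈ genericPoints v b e) :
    HasDominant v y (∑ d ∈ Finset.Icc 1 (degreeBound t I), tropPluecker v (b d) (e d) y)
      (groebnerPoly t I b e) := by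
  refine HasDominant.prod fun d _ => ?_
  obtain ⟨J, hJ⟩ := exists_isArgmin (minorVal v (coeffMatrix (b d) (e d)))
    (minorExp (coeffMatrix (b d) (e d)) (expOf (e d))) y
  rw [tropPluecker, hJ.tropMin_eq]
  exact hasDominant_plueckerPoly (b d) (e d) fun J' hne =>
    hJ.lt_of_exp_eq (expOf_injective _) (fun J' hJ' => exp_eq_of_mem_genericSet hy hJ hJ') hne

theorem groebnerPoly_ne_zero : groebnerPoly t I b e ≠ 0 := by
  obtain ⟨y, hy⟩ := (dense_genericSet v (fun d => coeffMatrix (b d) (e d))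
    (fun d => expOf (e d))).nonempty
  exact (hasDominant_groebnerPoly t b e hy).ne_zero_and_trop_eq.1

instance : Nonempty {u // u ∈ (groebnerPoly t I b e).support} := by
  obtain ⟨u, hu⟩ := support_nonempty.2 (groebnerPoly_ne_zero t b e)
  exact ⟨⟨u, hu⟩⟩

/-- Both sides are continuous and agree on the dense set of generic points, so possible cancellation
elsewhere is harmless. -/
theorem trop_groebnerPoly : trop v (groebnerPoly t I b e) =
    fun y => ∑ d ∈ Finset.Icc 1 (degreeBound t I), tropPluecker v (b d) (e d) y := by
  refine Continuous.ext_on (dense_genericSet v (fun d => coeffMatrix (b d) (e d))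
    (fun d => expOf (e d))) ?_ ?_ fun y hy =>
      (hasDominant_groebnerPoly t b e hy).ne_zero_and_trop_eq.2
  · rw [trop_eq_tropMin]
    exact continuous_tropMin _ _
  · exact continuous_finsetSum _ fun d _ => continuous_tropMin _ _

end TropPluecker

/-! ### Residues and the powers of a splitting -/

section Residue

variable {K : Type*} [Field K] {v : AddValuation K (WithTop ℝ)}

theorem residue_of_nonneg {a : K} (h : 0 ≤ v a) :
    residue v a = IsLocalRing.residue (valRing v) ⟨a, h⟩ := dif_pos (show a ∈ valRing v from h)

theorem residue_zero : residue v 0 = 0 := by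
  rw [residue_of_nonneg (by simp)]
  exact map_zero (IsLocalRing.residue (valRing v))

theorem residue_one : residue v 1 = 1 := by
  rw [residue_of_nonneg (by simp)]
  exact map_one (IsLocalRing.residue (valRing v))

theorem residue_mul {a b : K} (ha : 0 ≤ v a) (hb : 0 ≤ v b) :
    residue v (a * b) = residue v a * residue v b := by
  rw [residue_of_nonneg ha, residue_of_nonneg hb,
    residue_of_nonneg (by rw [v.map_mul]; exact add_nonneg ha hb), ← map_mul]
  rfl

theorem residue_add {a b : K} (ha : 0 ≤ v a) (hb : 0 ≤ v b) :
    residue v (a + b) = residue v a + residue v b := by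
  rw [residue_of_nonneg ha, residue_of_nonneg hb,
    residue_of_nonneg (v.map_le_add ha hb), ← map_add]
  rfl

theorem residue_sum {ι : Type*} (S : Finset ι) (f : ι → K) (h : ∀ i ∈ S, 0 ≤ v (f i)) :
    residue v (∑ i ∈ S, f i) = ∑ i ∈ S, residue v (f i) := by
  classical
  induction S using Finset.induction_on with
  | empty => simp [residue_zero]
  | insert a S ha ih =>
    have hS : ∀ i ∈ S, 0 ≤ v (f i) := fun i hi => h i (Finset.mem_insert_of_mem hi)
    rw [Finset.sum_insert ha, Finset.sum_insert ha,
      residue_add (h a (Finset.mem_insert_self _ _)) (v.map_le_sum hS), ih hS]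

theorem residue_eq_zero {a : K} (h : 0 < v a) : residue v a = 0 := by
  rw [residue_of_nonneg h.le, IsLocalRing.residue_eq_zero_iff, IsLocalRing.mem_maximalIdeal,
    mem_nonunits_iff]
  intro hu
  obtain ⟨b, hb⟩ := hu.exists_right_inv
  have h1 : a * b.1 = 1 := congrArg Subtype.val hb
  have h2 : v a + v b.1 = 0 := by rw [← v.map_mul, h1, v.map_one]
  have h3 : 0 ≤ v b.1 := b.2
  have h4 : 0 < v a + v b.1 := lt_of_lt_of_le h (le_add_of_nonneg_right h3)
  exact h4.ne' h2

theorem Splitting.v_pow (t : Splitting v) (γ : valueGroup v) :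
    v (t.pow γ) = ((γ : ℝ) : WithTop ℝ) := t.val_hom γ

theorem Splitting.pow_zero (t : Splitting v) : t.pow 0 = 1 := by
  simp [Splitting.pow]

theorem Splitting.pow_add (t : Splitting v) (γ δ : valueGroup v) :
    t.pow (γ + δ) = t.pow γ * t.pow δ := by
  simp [Splitting.pow]

end Residue

/-! ### Initial forms -/

section InitialForm

variable {K : Type*} [Field K] {v : AddValuation K (WithTop ℝ)} {n : ℕ} (t : Splitting v)
  (w : Fin (n + 1) → valueGroup v)

/-- The dot product `w · u`, as an element of the value group. -/
def dotGroup (w : Fin (n + 1) → valueGroup v) (u : Fin (n + 1) →₀ ℕ) : valueGroup v :=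
  ∑ i, u i • w i

theorem coe_dotGroup (u : Fin (n + 1) →₀ ℕ) : (dotGroup w u : ℝ) = dot (toReal w) u := by
  simp [dotGroup, dot, toReal, mul_comm]

theorem dotGroup_add (u u' : Fin (n + 1) →₀ ℕ) :
    dotGroup w (u + u') = dotGroup w u + dotGroup w u' := by
  apply Subtype.ext
  rw [AddSubgroup.coe_add]
  simp only [coe_dotGroup, dot_add_right]

theorem dotGroup_single (i : Fin (n + 1)) : dotGroup w (Finsupp.single i 1) = w i := by
  apply Subtype.ext
  rw [coe_dotGroup, dot_single_one]
  rfl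

theorem weightGE_trop (f : MvPolynomial (Fin (n + 1)) K) (y : Fin (n + 1) → ℝ) :
    WeightGE v y (trop v f y) f := fun u => by
  by_cases hu : coeff u f = 0
  · simp [hu]
  rw [← coe_val v hu, WithTop.coe_le_coe]
  have h1 : trop v f y ≤ val v (coeff u f) + dot y u :=
    ciInf_le (Set.finite_range _).bddBelow
      (⟨u, mem_support_iff.2 hu⟩ : {u' // u' ∈ f.support})
  linarith

theorem exists_coeff_eq_trop {f : MvPolynomial (Fin (n + 1)) K} (hf : f ≠ 0)
    (y : Fin (n + 1) → ℝ) :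
    ∃ u, v (coeff u f) = ((trop v f y - dot y u : ℝ) : WithTop ℝ) := by
  obtain ⟨u₀, hu₀⟩ := support_nonempty.2 hf
  have : Nonempty {u // u ∈ f.support} := ⟨⟨u₀, hu₀⟩⟩
  obtain ⟨u, hu⟩ := exists_isArgmin (fun u : {u // u ∈ f.support} => val v (coeff u.1 f))
    (fun u => u.1) y
  refine ⟨u.1, ?_⟩
  rw [trop_eq_tropMin, hu.tropMin_eq, aff, add_sub_cancel_right,
    coe_val v (mem_support_iff.1 u.2)]

theorem exists_trop_eq (f : MvPolynomial (Fin (n + 1)) K) :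
    ∃ r : valueGroup v, trop v f (toReal w) = r := by
  by_cases hf : f = 0
  -- For f = 0 the infimum is over the empty set, with default value 0.
  · refine ⟨0, ?_⟩
    have : IsEmpty {u // u ∈ f.support} := ⟨fun u => by simpa [hf] using u.2⟩
    rw [trop, Real.iInf_of_isEmpty]
    rfl
  · obtain ⟨u, hu⟩ := exists_coeff_eq_trop (v := v) hf (toReal w)
    have hu0 : coeff u f ≠ 0 := by
      rw [← v.ne_top_iff, hu]
      exact WithTop.coe_ne_top
    rw [← coe_val v hu0, WithTop.coe_inj] at hu
    refine ⟨⟨val v (coeff u f), val_mem_valueGroup v _⟩ + dotGroup w u, ?_⟩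
    rw [AddSubgroup.coe_add, coe_dotGroup]
    simp only
    linarith

theorem v_pow_mul (γ r : valueGroup v) (c : K) :
    v (t.pow (γ - r) * c) = ((γ - r : ℝ) : WithTop ℝ) + v c := by
  rw [v.map_mul, t.v_pow, AddSubgroup.coe_sub]

theorem v_pow_mul_nonneg {γ r : valueGroup v} {c : K}
    (h : ((r - γ : ℝ) : WithTop ℝ) ≤ v c) : 0 ≤ v (t.pow (γ - r) * c) := by
  rw [v_pow_mul]
  calc (0 : WithTop ℝ) = ((γ - r : ℝ) : WithTop ℝ) + ((r - γ : ℝ) : WithTop ℝ) := by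
        rw [← WithTop.coe_add]; simp
    _ ≤ _ := add_le_add_right h _

theorem v_pow_mul_pos {γ r : valueGroup v} {c : K}
    (h : ((r - γ : ℝ) : WithTop ℝ) < v c) : 0 < v (t.pow (γ - r) * c) := by
  rw [v_pow_mul]
  calc (0 : WithTop ℝ) = ((γ - r : ℝ) : WithTop ℝ) + ((r - γ : ℝ) : WithTop ℝ) := by
        rw [← WithTop.coe_add]; simp
    _ < _ := WithTop.add_lt_add_left WithTop.coe_ne_top h

/-- For a term of minimal weight the power of t is t^(−val c_u). Every other term has positive
valuation after this scaling and dies in the residue field, so one formula covers all u. -/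
theorem coeff_initialForm {f : MvPolynomial (Fin (n + 1)) K} {r : valueGroup v}
    (hr : trop v f (toReal w) = r) (u : Fin (n + 1) →₀ ℕ) :
    coeff u (initialForm t w f) = residue v (t.pow (dotGroup w u - r) * coeff u f) := by
  classical
  rw [initialForm, coeff_sum]
  simp only [coeff_monomial]
  rw [Finset.sum_ite_eq']
  by_cases hu : coeff u f = 0
  · rw [if_neg (by simp [hu]), hu, mul_zero, residue_zero]
  have hle := weightGE_trop (v := v) f (toReal w) u
  split_ifs with h
  · rw [Splitting.lead]
    have h1 := (Finset.mem_filter.1 h).2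
    congr 3
    apply Subtype.ext
    rw [AddSubgroup.coe_sub, AddSubgroup.coe_neg, coe_dotGroup, ← hr]
    simp only
    linarith
  · refine (residue_eq_zero (v_pow_mul_pos t ?_)).symm
    rw [coe_dotGroup, ← hr]
    refine lt_of_le_of_ne hle fun heq => h ?_
    rw [← coe_val v hu, WithTop.coe_inj] at heq
    refine Finset.mem_filter.2 ⟨mem_support_iff.2 hu, ?_⟩
    linarith

theorem initialForm_zero : initialForm t w 0 = 0 := by
  rw [initialForm, support_zero, Finset.filter_empty, Finset.sum_empty]

theorem initialForm_X_mul (i : Fin (n + 1)) (f : MvPolynomial (Fin (n + 1)) K) :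
    initialForm t w (X i * f) = X i * initialForm t w f := by
  classical
  by_cases hf : f = 0
  · simp [hf, initialForm_zero]
  obtain ⟨r, hr⟩ := exists_trop_eq w f
  obtain ⟨u, hu⟩ := exists_coeff_eq_trop (v := v) hf (toReal w)
  have hge := weightGE_trop (v := v) f (toReal w)
  rw [hr] at hu hge
  have hsub : ∀ (m : Fin (n + 1) →₀ ℕ), i ∈ m.support →
      ∃ m', m = Finsupp.single i 1 + m' := fun m hm =>
    ⟨m - Finsupp.single i 1, (add_tsub_cancel_of_le (by
      simpa [Finsupp.single_le_iff, Nat.one_le_iff_ne_zero] using hm)).symm⟩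
  have hdot : ∀ m', dot (toReal w) (Finsupp.single i 1 + m') = (w i : ℝ) + dot (toReal w) m' :=
    fun m' => by
      rw [dot_add_right, dot_single_one]
      rfl
  have hr' : trop v (X i * f) (toReal w) = ((w i + r : valueGroup v) : ℝ) := by
    rw [AddSubgroup.coe_add]
    refine trop_eq (fun m => ?_) (u := Finsupp.single i 1 + u) ?_
    · by_cases hm : i ∈ m.support
      · obtain ⟨m', rfl⟩ := hsub m hm
        rw [coeff_X_mul, hdot, add_sub_add_left_eq_sub]
        exact hge m'
      · rw [coeff_X_mul', if_neg hm]
        simp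
    · rw [coeff_X_mul, hu, hdot, add_sub_add_left_eq_sub]
  ext m
  rw [coeff_initialForm t w hr']
  by_cases hm : i ∈ m.support
  · obtain ⟨m', rfl⟩ := hsub m hm
    rw [coeff_X_mul, coeff_X_mul, coeff_initialForm t w hr, dotGroup_add, dotGroup_single,
      add_sub_add_left_eq_sub]
  · rw [coeff_X_mul', if_neg hm, coeff_X_mul', if_neg hm, mul_zero, residue_zero]

end InitialForm

/-! ### The homogeneous parts of initial ideals -/

section InitialPart

variable {K : Type*} [Field K] {v : AddValuation K (WithTop ℝ)} {n : ℕ} (t : Splitting v)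
  (w : Fin (n + 1) → valueGroup v) (I : Ideal (MvPolynomial (Fin (n + 1)) K))

/-- The span of the initial forms of the homogeneous elements of degree `d` of `I`. -/
noncomputable def initialPart (d : ℕ) :
    Submodule (ResField v) (MvPolynomial (Fin (n + 1)) (ResField v)) :=
  Submodule.span (ResField v) (initialForm t w '' (degreePart I d : Set _))

variable {t w I}

theorem mem_initialIdeal_of_mem_initialPart {d : ℕ} {h : MvPolynomial (Fin (n + 1)) (ResField v)}
    (hh : h ∈ initialPart t w I d) : h ∈ initialIdeal t w I := by
  have : initialPart t w I d ≤ (initialIdeal t w I).restrictScalars (ResField v) := by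
    rw [initialPart, Submodule.span_le]
    rintro _ ⟨f, hf, rfl⟩
    exact Ideal.subset_span ⟨f, hf.1, rfl⟩
  exact this hh

theorem X_mul_mem_initialPart (i : Fin (n + 1)) {d : ℕ}
    {h : MvPolynomial (Fin (n + 1)) (ResField v)} (hh : h ∈ initialPart t w I d) :
    X i * h ∈ initialPart t w I (d + 1) := by
  induction hh using Submodule.span_induction with
  | mem x hx =>
    obtain ⟨f, hf, rfl⟩ := hx
    refine Submodule.subset_span ⟨X i * f, ⟨I.mul_mem_left _ hf.1, ?_⟩, initialForm_X_mul t w i f⟩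
    have h1 : f.IsHomogeneous d := hf.2
    have h2 : (X i * f).IsHomogeneous (1 + d) := (isHomogeneous_X K i).mul h1
    exact Nat.add_comm 1 d ▸ h2
  | zero => simp
  | add x y _ _ hx hy => rw [mul_add]; exact Submodule.add_mem _ hx hy
  | smul a x _ hx => rw [mul_smul_comm]; exact Submodule.smul_mem _ _ hx

/-- If some term of f of degree d has minimal weight, then f and its component of degree d have the
same tropical value, and taking initial forms commutes with taking this component. Otherwise the
component of the initial form is zero. -/
theorem homogeneousComponent_initialForm_mem (hI : IsHomogeneousIdeal I)
    {f : MvPolynomial (Fin (n + 1)) K} (hf : f ∈ I) (d : ℕ) :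
    homogeneousComponent d (initialForm t w f) ∈ initialPart t w I d := by
  classical
  obtain ⟨r, hr⟩ := exists_trop_eq w f
  have hge := weightGE_trop (v := v) f (toReal w)
  rw [hr] at hge
  by_cases h : ∃ u, u.degree = d ∧ v (coeff u f) = ((r - dot (toReal w) u : ℝ) : WithTop ℝ)
  · obtain ⟨u, hud, hu⟩ := h
    have hr' : trop v (homogeneousComponent d f) (toReal w) = r := by
      refine trop_eq (u := u) (fun m => ?_) ?_
      · rw [coeff_homogeneousComponent]
        split_ifs
        · exact hge m
        · simp
      · rw [coeff_homogeneousComponent, if_pos hud, hu]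
    refine Submodule.subset_span ⟨homogeneousComponent d f,
      ⟨homogeneousComponent_mem_of_mem hI hf d, homogeneousComponent_mem _ _⟩, ?_⟩
    ext m
    rw [coeff_initialForm t w hr', coeff_homogeneousComponent, coeff_homogeneousComponent]
    split_ifs
    · rw [coeff_initialForm t w hr]
    · rw [mul_zero, residue_zero]
  · have : homogeneousComponent d (initialForm t w f) = 0 := by
      ext m
      rw [coeff_homogeneousComponent, coeff_zero]
      split_ifs with hm
      · rw [coeff_initialForm t w hr]
        refine residue_eq_zero (v_pow_mul_pos t ?_)
        rw [coe_dotGroup]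
        exact lt_of_le_of_ne (hge m) fun heq => h ⟨m, hm, heq.symm⟩
      · rfl
    rw [this]
    exact Submodule.zero_mem _

/-- This reduces the ideal in_w(I) to linear algebra in each degree. The elements all of whose
components lie in the respective initial parts are stable under multiplication by variables, hence
by all polynomials. -/
theorem homogeneousComponent_mem_initialPart (hI : IsHomogeneousIdeal I)
    {h : MvPolynomial (Fin (n + 1)) (ResField v)} (hh : h ∈ initialIdeal t w I) (d : ℕ) :
    homogeneousComponent d h ∈ initialPart t w I d := by
  classical
  have hX : ∀ (i : Fin (n + 1)) (g : MvPolynomial (Fin (n + 1)) (ResField v)),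
      (∀ d, homogeneousComponent d g ∈ initialPart t w I d) →
        ∀ d, homogeneousComponent d (X i * g) ∈ initialPart t w I d := by
    intro i g hg d
    cases d with
    | zero =>
      have : homogeneousComponent 0 (X i * g) = 0 := by
        rw [homogeneousComponent_zero, coeff_X_mul']
        simp
      rw [this]
      exact Submodule.zero_mem _
    | succ d =>
      have : homogeneousComponent (d + 1) (X i * g) = X i * homogeneousComponent d g := by
        ext m
        rw [coeff_homogeneousComponent, coeff_X_mul', coeff_X_mul', coeff_homogeneousComponent]
        by_cases hm : i ∈ m.support
        · obtain ⟨m', rfl⟩ : ∃ m', m = Finsupp.single i 1 + m' :=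
            ⟨m - Finsupp.single i 1, (add_tsub_cancel_of_le (by
              simpa [Finsupp.single_le_iff, Nat.one_le_iff_ne_zero] using hm)).symm⟩
          rw [if_pos hm, if_pos hm, add_tsub_cancel_left, map_add, Finsupp.degree_single]
          simp only [add_comm 1, Nat.add_right_cancel_iff]
        · rw [if_neg hm, if_neg hm, ite_self]
      rw [this]
      exact X_mul_mem_initialPart i (hg d)
  have hmul : ∀ (a g : MvPolynomial (Fin (n + 1)) (ResField v)),
      (∀ d, homogeneousComponent d g ∈ initialPart t w I d) →
        ∀ d, homogeneousComponent d (a * g) ∈ initialPart t w I d := by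
    intro a
    induction a using MvPolynomial.induction_on with
    | C c =>
      intro g hg d
      rw [homogeneousComponent_C_mul, ← smul_eq_C_mul]
      exact Submodule.smul_mem _ _ (hg d)
    | add p q hp hq =>
      intro g hg d
      rw [add_mul, map_add]
      exact Submodule.add_mem _ (hp g hg d) (hq g hg d)
    | mul_X p i hp =>
      intro g hg
      rw [mul_assoc]
      exact hp _ (hX i g hg)
  revert d
  induction hh using Submodule.span_induction with
  | mem x hx =>
    obtain ⟨f, hf, rfl⟩ := hx
    exact homogeneousComponent_initialForm_mem hI hf
  | zero => simp
  | add x y _ _ hx hy =>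
    intro d
    rw [map_add]
    exact Submodule.add_mem _ (hx d) (hy d)
  | smul a x _ hx => exact hmul a x hx

end InitialPart

/-! ### Reduced bases -/

section ReducedBasis

variable {K : Type*} [Field K] {v : AddValuation K (WithTop ℝ)} {n : ℕ} {t : Splitting v}
  {w : Fin (n + 1) → valueGroup v} {I : Ideal (MvPolynomial (Fin (n + 1)) K)} {d s N : ℕ}
  {b : Module.Basis (Fin s) K (degreePart I d)} {e : Fin N ≃ Mon n d}

/-- The basis of the degree `d` part of `I` whose coefficients in the columns `J` form an identity
matrix. -/
noncomputable def reducedPoly (J : ColBasis (coeffMatrix b e)) (i : Fin s) :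
    MvPolynomial (Fin (n + 1)) K :=
  ∑ k, ((coeffMatrix b e).submatrix id J.col)⁻¹ i k • (b k).1

/-- The exponent of the monomial in the `i`-th column of `J`. -/
noncomputable def colExp (J : ColBasis (coeffMatrix b e)) (i : Fin s) : Fin (n + 1) →₀ ℕ := expOf e (J.col i)

theorem colExp_injective (J : ColBasis (coeffMatrix b e)) : Function.Injective (colExp J) :=
  (expOf_injective e).comp J.col.injective

theorem degree_colExp (J : ColBasis (coeffMatrix b e)) (i : Fin s) : (colExp J i).degree = d :=
  degree_expOf e _

theorem reducedPoly_mem (J : ColBasis (coeffMatrix b e)) (i : Fin s) :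
    reducedPoly J i ∈ degreePart I d :=
  Submodule.sum_mem _ fun k _ => Submodule.smul_mem _ _ (b k).2

theorem coeff_reducedPoly (J : ColBasis (coeffMatrix b e)) (i : Fin s) (j : Fin N) :
    coeff (expOf e j) (reducedPoly J i) = J.reduced i j := by
  simp [reducedPoly, coeff_sum, ColBasis.reduced, Matrix.mul_apply, coeffMatrix, expOf]

/-- The rows of the reduced matrix span I_d, and the coordinates are read off in the columns J,
where that matrix is the identity. -/
theorem coeff_eq_sum_reduced (J : ColBasis (coeffMatrix b e)) {f : MvPolynomial (Fin (n + 1)) K}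
    (hf : f ∈ degreePart I d) (j : Fin N) :
    coeff (expOf e j) f = ∑ i, coeff (colExp J i) f * J.reduced i j := by
  let x : Fin s → K := b.repr ⟨f, hf⟩
  have hx : ∀ j, coeff (expOf e j) f = Matrix.vecMul x (coeffMatrix b e) j := by
    intro j
    have h1 : (∑ k, x k • (b k).1) = f := by
      have := congrArg (degreePart I d).subtype (b.sum_repr ⟨f, hf⟩)
      rwa [map_sum] at this
    conv_lhs => rw [← h1]
    simp [coeff_sum, Matrix.vecMul, dotProduct, coeffMatrix, expOf]
  rw [hx]
  conv_lhs => rw [← J.submatrix_mul_reduced, ← Matrix.vecMul_vecMul]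
  rw [Matrix.vecMul, dotProduct]
  exact Finset.sum_congr rfl fun i _ => by rw [colExp, hx]; rfl

theorem coeff_colExp_reducedPoly (J : ColBasis (coeffMatrix b e)) (i k : Fin s) :
    coeff (colExp J k) (reducedPoly J i) = if i = k then 1 else 0 := by
  rw [colExp, coeff_reducedPoly, J.reduced_apply_col]

variable {J : ColBasis (coeffMatrix b e)}

theorem trop_reducedPoly (hJ : IsMinBasis v b e (toReal w) J) (i : Fin s) :
    trop v (reducedPoly J i) (toReal w) = dotGroup w (colExp J i) := by
  rw [coe_dotGroup]
  refine trop_eq (fun u => ?_) (u := colExp J i) ?_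
  · by_cases hu : u.degree = d
    · obtain ⟨j, rfl⟩ := exists_expOf e hu
      rw [coeff_reducedPoly]
      exact IsArgmin.le_reduced hJ i j
    · rw [coeff_eq_zero_of_mem_degreePart (reducedPoly_mem J i) hu]
      simp
  · rw [coeff_colExp_reducedPoly, if_pos rfl]
    simp

theorem coeff_colExp_initialForm_reducedPoly (hJ : IsMinBasis v b e (toReal w) J) (i k : Fin s) :
    coeff (colExp J k) (initialForm t w (reducedPoly J i)) = if i = k then 1 else 0 := by
  rw [coeff_initialForm t w (trop_reducedPoly hJ i), coeff_colExp_reducedPoly]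
  split_ifs with h
  · rw [h, sub_self, t.pow_zero, mul_one, residue_one]
  · rw [mul_zero, residue_zero]

theorem coeff_initialForm_eq_zero {f : MvPolynomial (Fin (n + 1)) K} (hf : f ∈ degreePart I d)
    {u : Fin (n + 1) →₀ ℕ} (hu : u.degree ≠ d) : coeff u (initialForm t w f) = 0 := by
  obtain ⟨r, hr⟩ := exists_trop_eq w f
  rw [coeff_initialForm t w hr, coeff_eq_zero_of_mem_degreePart hf hu, mul_zero, residue_zero]

/-- The initial forms of the reduced basis with respect to a minimal `J` span the initial forms. -/
theorem eq_sum_of_mem_initialPart (hJ : IsMinBasis v b e (toReal w) J)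
    {h : MvPolynomial (Fin (n + 1)) (ResField v)} (hh : h ∈ initialPart t w I d) :
    h = ∑ i, coeff (colExp J i) h • initialForm t w (reducedPoly J i) := by
  induction hh using Submodule.span_induction with
  | mem x hx =>
    obtain ⟨f, hf, rfl⟩ := hx
    obtain ⟨r, hr⟩ := exists_trop_eq w f
    have hge := weightGE_trop (v := v) f (toReal w)
    rw [hr] at hge
    ext u
    rw [coeff_sum]
    by_cases hu : u.degree = d
    swap
    · rw [coeff_initialForm_eq_zero hf hu, Finset.sum_eq_zero fun i _ => ?_]
      rw [coeff_smul, coeff_initialForm_eq_zero (reducedPoly_mem J i) hu, smul_zero]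
    obtain ⟨j, rfl⟩ := exists_expOf e hu
    -- The power of t is divided so that both factors have nonnegative valuation; on such elements
    -- the residue is multiplicative.
    have hterm : ∀ i, t.pow (dotGroup w (expOf e j) - r) *
        (coeff (colExp J i) f * J.reduced i j) =
        (t.pow (dotGroup w (colExp J i) - r) * coeff (colExp J i) f) *
          (t.pow (dotGroup w (expOf e j) - dotGroup w (colExp J i)) * J.reduced i j) := by
      intro i
      have : dotGroup w (expOf e j) - r = (dotGroup w (colExp J i) - r) +
        (dotGroup w (expOf e j) - dotGroup w (colExp J i)) := by abel
      rw [this, t.pow_add]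
      ring
    have h1 : ∀ i, 0 ≤ v (t.pow (dotGroup w (colExp J i) - r) * coeff (colExp J i) f) :=
      fun i => v_pow_mul_nonneg t (by rw [coe_dotGroup]; exact hge _)
    have h2 : ∀ i, 0 ≤ v (t.pow (dotGroup w (expOf e j) - dotGroup w (colExp J i)) *
        J.reduced i j) := fun i => v_pow_mul_nonneg t (by
      rw [coe_dotGroup, coe_dotGroup]
      exact IsArgmin.le_reduced hJ i j)
    rw [coeff_initialForm t w hr, coeff_eq_sum_reduced J hf, Finset.mul_sum, residue_sum]
    · refine Finset.sum_congr rfl fun i _ => ?_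
      rw [hterm, residue_mul (h1 i) (h2 i), coeff_smul, smul_eq_mul, coeff_initialForm t w hr,
        coeff_initialForm t w (trop_reducedPoly hJ i), coeff_reducedPoly]
    · intro i _
      rw [hterm, v.map_mul]
      exact add_nonneg (h1 i) (h2 i)
  | zero => simp
  | add x y _ _ hx hy =>
    simp only [coeff_add, add_smul, Finset.sum_add_distrib]
    rw [← hx, ← hy]
  | smul a x _ hx =>
    simp only [coeff_smul, smul_eq_mul, mul_smul]
    rw [← Finset.smul_sum, ← hx]

theorem initialForm_reducedPoly_mem (J : ColBasis (coeffMatrix b e)) (i : Fin s) :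
    initialForm t w (reducedPoly J i) ∈ initialPart t w I d :=
  Submodule.subset_span ⟨_, reducedPoly_mem J i, rfl⟩

/-- If `J` is the only minimal basis, the initial forms of the reduced basis are monomials. -/
theorem monomial_mem_of_unique (hJ : IsMinBasis v b e (toReal w) J)
    (huniq : ∀ J', IsMinBasis v b e (toReal w) J' → J' = J) (i : Fin s) :
    monomial (colExp J i) (1 : ResField v) ∈ initialIdeal t w I := by
  classical
  have : initialForm t w (reducedPoly J i) = monomial (colExp J i) 1 := by
    ext u
    rw [coeff_monomial]
    by_cases hu : u.degree = d
    swap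
    · rw [coeff_initialForm_eq_zero (reducedPoly_mem J i) hu, if_neg]
      rintro rfl
      exact hu (degree_colExp J i)
    obtain ⟨j, rfl⟩ := exists_expOf e hu
    by_cases hj : j ∈ J.1.1
    · obtain ⟨k, rfl⟩ := J.exists_col_eq hj
      have := coeff_colExp_initialForm_reducedPoly (t := t) hJ i k
      rw [colExp] at this
      rw [this]
      exact if_congr (colExp_injective J).eq_iff.symm rfl rfl
    · rw [if_neg fun h : colExp J i = expOf e j =>
          hj ((expOf_injective e h : J.col i = j) ▸ J.col_mem i),
        coeff_initialForm t w (trop_reducedPoly hJ i), coeff_reducedPoly]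
      refine residue_eq_zero (v_pow_mul_pos t ?_)
      rw [coe_dotGroup, coe_dotGroup]
      exact IsArgmin.lt_reduced_of_exp_eq (expOf_injective e) hJ
        (fun J' hJ' => by rw [huniq J' hJ']) i hj
  rw [← this]
  exact mem_initialIdeal_of_mem_initialPart (initialForm_reducedPoly_mem J i)

/-- The monomials of degree `d` in the initial ideal belong to every minimal basis. -/
theorem exists_colExp_of_monomial_mem (hI : IsHomogeneousIdeal I)
    (hJ : IsMinBasis v b e (toReal w) J) {u : Fin (n + 1) →₀ ℕ} (hu : u.degree = d)
    (hmem : monomial u (1 : ResField v) ∈ initialIdeal t w I) :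
    ∃ i, colExp J i = u ∧ initialForm t w (reducedPoly J i) = monomial u 1 := by
  classical
  have h1 := homogeneousComponent_mem_initialPart hI hmem d
  rw [homogeneousComponent_eq_self (isHomogeneous_monomial _ hu)] at h1
  have h2 := eq_sum_of_mem_initialPart hJ h1
  by_cases h : ∃ i, colExp J i = u
  · obtain ⟨i, rfl⟩ := h
    refine ⟨i, rfl, ?_⟩
    rw [h2, Finset.sum_eq_single i]
    · simp
    · intro k _ hk
      rw [coeff_monomial, if_neg fun h => hk (colExp_injective J h.symm), zero_smul]
    · simp
  -- If u is not in J, all coefficients of the expansion vanish, and the monomial would be zero.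
  · push Not at h
    rw [Finset.sum_eq_zero fun i _ => by
      rw [coeff_monomial, if_neg fun h' => h i h'.symm, zero_smul]] at h2
    exact absurd h2 (by simp)

theorem ncard_range_colExp (J : ColBasis (coeffMatrix b e)) :
    (Set.range (colExp J)).ncard = s := by
  rw [← Set.image_univ, Set.ncard_image_of_injective _ (colExp_injective J), Set.ncard_univ]
  simp

/-- If the initial ideal is monomial, then every minimal basis consists of its monomials. -/
theorem setOf_monomial_mem_eq (hI : IsHomogeneousIdeal I) (hJ : IsMinBasis v b e (toReal w) J)
    (hM : IsMonomialIdeal (initialIdeal t w I)) :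
    {u | monomial u (1 : ResField v) ∈ initialIdeal t w I ∧ u.degree = d} =
      Set.range (colExp J) := by
  ext u
  constructor
  · rintro ⟨h1, h2⟩
    obtain ⟨i, hi, -⟩ := exists_colExp_of_monomial_mem hI hJ h2 h1
    exact ⟨i, hi⟩
  · rintro ⟨i, rfl⟩
    refine ⟨?_, degree_colExp J i⟩
    have h1 := mem_initialIdeal_of_mem_initialPart
      (initialForm_reducedPoly_mem (t := t) (w := w) J i)
    obtain ⟨S, hS⟩ := hM
    rw [hS, mem_ideal_span_monomial_image] at h1 ⊢
    -- The i-th initial form has coefficient 1 at `colExp J i`, and a monomial ideal contains every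
    -- monomial of its elements.
    obtain ⟨m, hm, hle⟩ := h1 (colExp J i) (by
      rw [mem_support_iff, coeff_colExp_initialForm_reducedPoly hJ, if_pos rfl]
      exact one_ne_zero)
    intro u hu
    rw [Finset.mem_singleton.1 (support_monomial_subset hu)]
    exact ⟨m, hm, hle⟩

end ReducedBasis

/-! ### Monomial initial ideals -/

section MonomialIdeal

variable {n : ℕ} {F : Type*} [Field F]

theorem monomial_mem_of_le {M : Ideal (MvPolynomial (Fin (n + 1)) F)} {u u' : Fin (n + 1) →₀ ℕ}
    (h : u ≤ u') (hu : monomial u (1 : F) ∈ M) : monomial u' (1 : F) ∈ M := by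
  have : monomial u' (1 : F) = monomial (u' - u) 1 * monomial u 1 := by
    rw [monomial_mul, tsub_add_cancel_of_le h, one_mul]
  rw [this]
  exact M.mul_mem_left _ hu

theorem monomial_mem_span_iff {U : Set (Fin (n + 1) →₀ ℕ)} (hU : IsUpperSet U)
    {u : Fin (n + 1) →₀ ℕ} :
    monomial u (1 : F) ∈ Ideal.span ((fun u => monomial u (1 : F)) '' U) ↔ u ∈ U := by
  constructor
  · intro h
    rw [mem_ideal_span_monomial_image] at h
    obtain ⟨m, hm, hle⟩ := h u (by simp [mem_support_iff])
    exact hU hle hm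
  · exact fun h => Ideal.subset_span ⟨u, h, rfl⟩

end MonomialIdeal

/-! ### Initial ideals and minimal bases in all degrees -/

section InitialMonomial

variable {K : Type*} [Field K] {v : AddValuation K (WithTop ℝ)} {n : ℕ} {t : Splitting v}
  {I : Ideal (MvPolynomial (Fin (n + 1)) K)}

section Degree

variable {d s N : ℕ} {b : Module.Basis (Fin s) K (degreePart I d)} {e : Fin N ≃ Mon n d}

/-- The columns `J` have smaller weight at `y` than any other basis of the columns. -/
def IsStrictMinBasis (v : AddValuation K (WithTop ℝ)) (b : Module.Basis (Fin s) K (degreePart I d))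
    (e : Fin N ≃ Mon n d) (y : Fin (n + 1) → ℝ) (J : ColBasis (coeffMatrix b e)) : Prop :=
  ∀ J', J' ≠ J → aff (minorVal v _ J) (minorExp _ (expOf e) J) y <
    aff (minorVal v _ J') (minorExp _ (expOf e) J') y

variable {y : Fin (n + 1) → ℝ} {J : ColBasis (coeffMatrix b e)}

theorem IsStrictMinBasis.isMinBasis (h : IsStrictMinBasis v b e y J) : IsMinBasis v b e y J := by
  intro J'
  rcases eq_or_ne J' J with rfl | hne
  · exact le_rfl
  · exact (h J' hne).le

theorem IsStrictMinBasis.eq (h : IsStrictMinBasis v b e y J) {J' : ColBasis (coeffMatrix b e)}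
    (hJ' : IsMinBasis v b e y J') : J' = J := by
  by_contra hne
  exact absurd (hJ' J) (not_le.2 (h J' hne))

theorem IsStrictMinBasis.eventually (h : IsStrictMinBasis v b e y J) :
    ∀ᶠ x in nhds y, IsStrictMinBasis v b e x J := by
  simp only [IsStrictMinBasis]
  rw [Filter.eventually_all]
  intro J'
  by_cases hne : J' = J
  · exact Filter.Eventually.of_forall fun x h => absurd hne h
  · exact ((continuous_aff _ _).continuousAt.eventually_lt (continuous_aff _ _).continuousAt
      (h J' hne)).mono fun x hx _ => hx

theorem exists_isMinBasis (v : AddValuation K (WithTop ℝ))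
    (b : Module.Basis (Fin s) K (degreePart I d)) (e : Fin N ≃ Mon n d) (y : Fin (n + 1) → ℝ) :
    ∃ J, IsMinBasis v b e y J := exists_isArgmin _ _ y

theorem range_colExp (J : ColBasis (coeffMatrix b e)) :
    Set.range (colExp J) = expOf e '' (J.1.1 : Set (Fin N)) := by
  ext u
  constructor
  · rintro ⟨i, rfl⟩
    exact ⟨J.col i, J.col_mem i, rfl⟩
  · rintro ⟨j, hj, rfl⟩
    obtain ⟨i, rfl⟩ := J.exists_col_eq hj
    exact ⟨i, rfl⟩

theorem eq_of_range_colExp_eq {J J' : ColBasis (coeffMatrix b e)}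
    (h : Set.range (colExp J) = Set.range (colExp J')) : J = J' := by
  rw [range_colExp, range_colExp, (expOf_injective e).image_injective.eq_iff] at h
  exact Subtype.ext (Subtype.ext (Finset.coe_injective h))

end Degree

variable {s N : ℕ → ℕ} {b : ∀ d, Module.Basis (Fin (s d)) K (degreePart I d)}
  {e : ∀ d, Fin (N d) ≃ Mon n d}

/-- The product g has no factor of degree 0, so uniqueness in that degree needs its own reason:
there is only one monomial. -/
theorem colBasis_degree_zero_subsingleton {s N : ℕ} {b : Module.Basis (Fin s) K (degreePart I 0)}
    {e : Fin N ≃ Mon n 0} (J J' : ColBasis (coeffMatrix b e)) : J = J' := by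
  have hsub : Subsingleton (Fin N) := by
    refine ⟨fun i j => e.injective (Subtype.ext ?_)⟩
    rw [(Finsupp.degree_eq_zero_iff _).1 (e i).2, (Finsupp.degree_eq_zero_iff _).1 (e j).2]
  refine Subtype.ext (Subtype.ext ?_)
  rcases J.1.1.eq_empty_or_nonempty with h | ⟨j, hj⟩
  · have h1 := J.1.2
    rw [h, Finset.card_empty, ← J'.1.2] at h1
    rw [h, Finset.card_eq_zero.1 h1.symm]
  · have h1 : 0 < J'.1.1.card := by
      rw [J'.1.2, ← J.1.2]
      exact Finset.card_pos.2 ⟨j, hj⟩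
    obtain ⟨j', hj'⟩ := Finset.card_pos.1 h1
    ext k
    exact iff_of_true (Subsingleton.elim j k ▸ hj) (Subsingleton.elim j' k ▸ hj')

theorem exists_isStrictMinBasis {y : Fin (n + 1) → ℝ} (hy : y ∈ genericPoints v b e) (d : ℕ) :
    ∃ J, IsStrictMinBasis v (b d) (e d) y J := by
  obtain ⟨J, hJ⟩ := exists_isMinBasis v (b d) (e d) y
  exact ⟨J, fun J' hne => IsArgmin.lt_of_exp_eq (expOf_injective _) hJ
    (fun J' hJ' => exp_eq_of_mem_genericSet hy hJ hJ') hne⟩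

theorem denseRange_toReal (hΓ : ∀ q : ℚ, (q : ℝ) ∈ valueGroup v) :
    DenseRange (toReal : (Fin (n + 1) → valueGroup v) → Fin (n + 1) → ℝ) := by
  have h1 : DenseRange ((↑) : valueGroup v → ℝ) := by
    refine Dense.mono ?_ (Rat.denseRange_cast (𝕜 := ℝ))
    rintro _ ⟨q, rfl⟩
    exact ⟨⟨q, hΓ q⟩, rfl⟩
  exact DenseRange.piMap fun _ => h1

/-- An initial ideal that contains the low degree part of a monomial ideal with the right Hilbert
function is equal to this ideal. -/
theorem initialIdeal_eq_span (b : ∀ d, Module.Basis (Fin (s d)) K (degreePart I d))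
    (e : ∀ d, Fin (N d) ≃ Mon n d) (hI : IsHomogeneousIdeal I)
    {w : Fin (n + 1) → valueGroup v} {U : Set (Fin (n + 1) →₀ ℕ)}
    (hcard : ∀ d, {u | u ∈ U ∧ u.degree = d}.ncard = s d) {D : ℕ}
    (hD : ∀ u, Minimal (· ∈ U) u → u.degree ≤ D)
    (hmem : ∀ u ∈ U, u.degree ≤ D → monomial u (1 : ResField v) ∈ initialIdeal t w I) :
    initialIdeal t w I = Ideal.span ((fun u => monomial u (1 : ResField v)) '' U) := by
  have hall : ∀ u ∈ U, monomial u (1 : ResField v) ∈ initialIdeal t w I := by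
    intro u hu
    obtain ⟨m, hmu, hm⟩ := exists_minimal_le hu
    exact monomial_mem_of_le hmu (hmem m hm.1 (hD m hm))
  refine le_antisymm (fun h hh => ?_) ?_
  · rw [← sum_homogeneousComponent h]
    refine Ideal.sum_mem _ fun d _ => ?_
    obtain ⟨J, hJ⟩ := exists_isMinBasis v (b d) (e d) (toReal w)
    have hsub : {u | u ∈ U ∧ u.degree = d} ⊆ Set.range (colExp J) := by
      rintro u ⟨hu, hud⟩
      obtain ⟨i, hi, -⟩ := exists_colExp_of_monomial_mem hI hJ hud (hall u hu)
      exact ⟨i, hi⟩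
    -- Both sides have s d elements, so the minimal basis is exactly the degree d part of U.
    have heq := Set.eq_of_subset_of_ncard_le hsub (by rw [ncard_range_colExp, hcard])
      (Set.finite_range _)
    rw [eq_sum_of_mem_initialPart hJ (homogeneousComponent_mem_initialPart hI hh d)]
    refine Ideal.sum_mem _ fun i _ => ?_
    have hi : colExp J i ∈ {u | u ∈ U ∧ u.degree = d} := heq ▸ ⟨i, rfl⟩
    obtain ⟨k, hk, hk'⟩ := exists_colExp_of_monomial_mem hI hJ hi.2 (hall _ hi.1)
    rw [colExp_injective J hk] at hk'
    rw [hk', smul_eq_C_mul]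
    exact Ideal.mul_mem_left _ _ (Ideal.subset_span ⟨_, hi.1, rfl⟩)
  · rw [Ideal.span_le]
    rintro _ ⟨u, hu, rfl⟩
    exact hall u hu

/-- The monomials of degree d in a monomial initial ideal are the columns of a minimal basis, so all
these ideals have the Hilbert function s. -/
theorem bddAbove_generatorDegrees (b : ∀ d, Module.Basis (Fin (s d)) K (degreePart I d))
    (e : ∀ d, Fin (N d) ≃ Mon n d) (hI : IsHomogeneousIdeal I) :
    BddAbove (generatorDegrees t I) := by
  obtain ⟨D, hD⟩ := exists_degree_bound_of_hilbert (Fin (n + 1)) s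
  refine ⟨D, ?_⟩
  rintro _ ⟨w, hM, u, hu, rfl⟩
  refine hD {u | monomial u (1 : ResField v) ∈ initialIdeal t w I}
    (fun u u' h hu => show monomial u' (1 : ResField v) ∈ initialIdeal t w I from
      monomial_mem_of_le h hu) (fun d => ?_) u hu
  obtain ⟨J, hJ⟩ := exists_isMinBasis v (b d) (e d) (toReal w)
  exact (congrArg Set.ncard (setOf_monomial_mem_eq hI hJ hM)).trans (ncard_range_colExp J)

/-- At a generic point, the minimal bases in all degrees form the exponents of a monomial ideal
with generators of degree at most `degreeBound t I`. -/
theorem exists_upperSet_of_generic (hΓ : ∀ q : ℚ, (q : ℝ) ∈ valueGroup v)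
    (hI : IsHomogeneousIdeal I) {y : Fin (n + 1) → ℝ}
    {J : ∀ d, ColBasis (coeffMatrix (b d) (e d))}
    (hJ : ∀ d, IsStrictMinBasis v (b d) (e d) y (J d)) :
    ∃ U : Set (Fin (n + 1) →₀ ℕ), IsUpperSet U ∧
      (∀ d, {u | u ∈ U ∧ u.degree = d} = Set.range (colExp (J d))) ∧
      ∀ u, Minimal (· ∈ U) u → u.degree ≤ degreeBound t I := by
  let U : Set (Fin (n + 1) →₀ ℕ) := {u | u ∈ Set.range (colExp (J u.degree))}
  have hU : ∀ d, {u | u ∈ U ∧ u.degree = d} = Set.range (colExp (J d)) := by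
    intro d
    ext u
    constructor
    · rintro ⟨h, rfl⟩
      exact h
    · rintro ⟨i, rfl⟩
      have hdeg := degree_colExp (J d) i
      refine ⟨?_, hdeg⟩
      change colExp (J d) i ∈ Set.range (colExp (J (colExp (J d) i).degree))
      rw [hdeg]
      exact ⟨i, rfl⟩
  have hmem : ∀ (w : Fin (n + 1) → valueGroup v) (u : Fin (n + 1) →₀ ℕ),
      IsStrictMinBasis v (b u.degree) (e u.degree) (toReal w) (J u.degree) →
      (monomial u (1 : ResField v) ∈ initialIdeal t w I ↔ u ∈ U) := by
    intro w u hw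
    constructor
    · intro h
      obtain ⟨i, hi, -⟩ := exists_colExp_of_monomial_mem hI hw.isMinBasis rfl h
      exact ⟨i, hi⟩
    · rintro ⟨i, hi⟩
      rw [← hi]
      exact monomial_mem_of_unique hw.isMinBasis (fun J' hJ' => hw.eq hJ') i
  -- Strict minimality is an open condition in each degree, so only finitely many degrees can be
  -- kept when y is moved to a point of Γ^{n+1}.
  have hnear : ∀ S : Set ℕ, S.Finite → ∃ w : Fin (n + 1) → valueGroup v, ∀ d ∈ S,
      IsStrictMinBasis v (b d) (e d) (toReal w) (J d) := by
    intro S hS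
    have h1 : ∀ᶠ x in nhds y, ∀ d ∈ S, IsStrictMinBasis v (b d) (e d) x (J d) :=
      (Filter.eventually_all_finite hS).2 fun d _ => (hJ d).eventually
    obtain ⟨_, ⟨w, rfl⟩, hx⟩ := (denseRange_toReal hΓ).inter_nhds_nonempty h1
    exact ⟨w, hx⟩
  have hup : IsUpperSet U := by
    intro u u' hle hu
    obtain ⟨w, hw⟩ := hnear {u.degree, u'.degree} (Set.toFinite _)
    have h1 := (hmem w u (hw _ (by simp))).2 hu
    exact (hmem w u' (hw _ (by simp))).1 (monomial_mem_of_le hle h1)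
  have hcard : ∀ d, {u | u ∈ U ∧ u.degree = d}.ncard = s d := fun d => by
    rw [hU, ncard_range_colExp]
  refine ⟨U, hup, hU, fun u hu => ?_⟩
  -- This bound depends only on s, so it is available before w is chosen. Agreement up to degree D
  -- makes U the set of monomials of an actual initial ideal, whose generator degrees `degreeBound`
  -- bounds.
  obtain ⟨D, hD⟩ := exists_degree_bound_of_hilbert (Fin (n + 1)) s
  obtain ⟨w, hw⟩ := hnear (Set.Iic D) (Set.finite_Iic D)
  have heq := initialIdeal_eq_span b e hI (t := t) hcard (hD U hup hcard)
    fun u hu hd => (hmem w u (hw _ hd)).2 hu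
  refine le_csSup (bddAbove_generatorDegrees b e hI) ⟨w, ⟨U, heq⟩, u, ?_, rfl⟩
  have hfun : (fun u' => monomial u' (1 : ResField v) ∈ initialIdeal t w I) = (· ∈ U) := by
    funext u'
    rw [heq]
    exact propext (monomial_mem_span_iff hup)
  rw [IsMinimalGenerator, hfun]
  exact hu

/-- A maximal cell of the coarsest complex for `trop(g)` is the closure of the class of initial
ideals of each of its interior points, and these initial ideals are monomial. -/
theorem maximal_cell_eq_closure_initialClass (hΓ : ∀ q : ℚ, (q : ℝ) ∈ valueGroup v)
    (hI : IsHomogeneousIdeal I) {S : PolyComplex (n + 1)}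
    (hS : S.IsCoarsest (trop v (groebnerPoly t I b e))) {σ : Set (Fin (n + 1) → ℝ)}
    (hσ : Maximal (fun P => P ∈ S.cells) σ) {w : Fin (n + 1) → valueGroup v}
    (hw : toReal w ∈ interior σ) :
    σ = closure (initialClass t I w) ∧ IsMonomialIdeal (initialIdeal t w I) := by
  have hcell := maximal_cell_eq_minCell
    (c := fun u : {u // u ∈ (groebnerPoly t I b e).support} =>
      val v (coeff u.1 (groebnerPoly t I b e))) (a := fun u => u.1) hS hσ hw
  set g := groebnerPoly t I b e with hg
  set D := degreeBound t I with hDdef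
  have htrop : ∀ x, trop v g x = ∑ d ∈ Finset.Icc 1 D, tropPluecker v (b d) (e d) x :=
    fun x => congrFun (trop_groebnerPoly t b e) x
  obtain ⟨i₀, hi₀⟩ := exists_isArgmin (fun u : {u // u ∈ g.support} => val v (coeff u.1 g))
    (fun u => u.1) (toReal w)
  have hlin : ∀ x ∈ σ, ∑ d ∈ Finset.Icc 1 D, tropPluecker v (b d) (e d) x =
      aff (val v (coeff i₀.1 g)) i₀.1 x := by
    intro x hx
    rw [← htrop]
    rw [hcell] at hx
    exact (hx i₀ hi₀).tropMin_eq
  -- The sum of the minimal weights is affine on σ, so each basis minimal at an interior point is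
  -- minimal on all of σ.
  have hpersist : ∀ {x x' : Fin (n + 1) → ℝ}, x ∈ interior σ → x' ∈ σ → ∀ d ∈ Finset.Icc 1 D,
      ∀ J : ColBasis (coeffMatrix (b d) (e d)), IsMinBasis v (b d) (e d) x J →
        IsMinBasis v (b d) (e d) x' J := fun hx hx' d hd J hJ =>
    IsArgmin.of_affine_sum (κ := fun d => ColBasis (coeffMatrix (b d) (e d))) (Finset.Icc 1 D)
      (fun d => minorVal v (coeffMatrix (b d) (e d)))
      (fun d => minorExp (coeffMatrix (b d) (e d)) (expOf (e d))) hlin hx hx' hd hJ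
  obtain ⟨y, hyσ, hy⟩ := (dense_genericSet v (fun d => coeffMatrix (b d) (e d))
    (fun d => expOf (e d))).inter_open_nonempty _ isOpen_interior ⟨_, hw⟩
  choose J hJ using fun d => exists_isStrictMinBasis (v := v) (b := b) (e := e) hy d
  obtain ⟨U, hup, hU, hUD⟩ := exists_upperSet_of_generic (t := t) hΓ hI hJ
  have hcard : ∀ d, {u | u ∈ U ∧ u.degree = d}.ncard = s d := fun d => by
    rw [hU, ncard_range_colExp]
  -- A basis minimal at x is also minimal at the generic point y, where `J d` is the only one.
  have huniq : ∀ {x : Fin (n + 1) → ℝ}, x ∈ interior σ → ∀ d ≤ D,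
      ∀ J', IsMinBasis v (b d) (e d) x J' → J' = J d := by
    intro x hx d hd J' hJ'
    rcases Nat.eq_zero_or_pos d with rfl | hpos
    · exact colBasis_degree_zero_subsingleton _ _
    · exact (hJ d).eq (hpersist hx (interior_subset hyσ) d (Finset.mem_Icc.2 ⟨hpos, hd⟩) J' hJ')
  have hmin : ∀ {x : Fin (n + 1) → ℝ}, x ∈ interior σ → ∀ d ≤ D,
      IsMinBasis v (b d) (e d) x (J d) := by
    intro x hx d hd
    obtain ⟨J', hJ'⟩ := exists_isMinBasis v (b d) (e d) x
    exact huniq hx d hd J' hJ' ▸ hJ'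
  have hideal : ∀ w' : Fin (n + 1) → valueGroup v, toReal w' ∈ interior σ →
      initialIdeal t w' I = Ideal.span ((fun u => monomial u (1 : ResField v)) '' U) := by
    intro w' hw'
    refine initialIdeal_eq_span b e hI hcard hUD fun u hu hd => ?_
    obtain ⟨i, hi⟩ : u ∈ Set.range (colExp (J u.degree)) := hU u.degree ▸ ⟨hu, rfl⟩
    rw [← hi]
    exact monomial_mem_of_unique (hmin hw' _ hd) (huniq hw' _ hd) i
  refine ⟨Set.Subset.antisymm ?_ ?_, U, hideal w hw⟩
  · have hconv : Convex ℝ σ := hcell ▸ minCell_convex _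
    calc σ ⊆ closure σ := subset_closure
      _ = closure (interior σ) :=
        (hconv.closure_interior_eq_closure_of_nonempty_interior ⟨_, hw⟩).symm
      _ ⊆ closure (closure (interior σ ∩ Set.range toReal)) :=
        closure_mono ((denseRange_toReal hΓ).open_subset_closure_inter isOpen_interior)
      _ = closure (interior σ ∩ Set.range toReal) := closure_closure
      _ ⊆ closure (initialClass t I w) := by
        refine closure_mono ?_
        rintro _ ⟨hx, w', rfl⟩
        exact ⟨w', rfl, by rw [hideal w' hx, hideal w hw]⟩
  · refine closure_minimal ?_ (hcell ▸ minCell_isClosed _)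
    rintro _ ⟨w', rfl, hw'⟩
    rw [hideal w hw] at hw'
    -- The ideal at w' is monomial with exponents U, which forces any minimal basis at w' to be `J
    -- d`.
    have hmin' : ∀ d, IsMinBasis v (b d) (e d) (toReal w') (J d) := by
      intro d
      obtain ⟨J', hJ'⟩ := exists_isMinBasis v (b d) (e d) (toReal w')
      have h1 := setOf_monomial_mem_eq hI hJ' ⟨U, hw'⟩
      have h2 : {u | monomial u (1 : ResField v) ∈ initialIdeal t w' I ∧ u.degree = d} =
          {u | u ∈ U ∧ u.degree = d} := by
        ext u
        refine and_congr_left fun _ => ?_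
        rw [hw']
        exact monomial_mem_span_iff hup
      rw [h2, hU] at h1
      exact eq_of_range_colExp_eq h1 ▸ hJ'
    let c := ∑ d ∈ Finset.Icc 1 D, minorVal v (coeffMatrix (b d) (e d)) (J d)
    let a := ∑ d ∈ Finset.Icc 1 D, minorExp (coeffMatrix (b d) (e d)) (expOf (e d)) (J d)
    have hsum : ∀ x, (∀ d ∈ Finset.Icc 1 D, IsMinBasis v (b d) (e d) x (J d)) →
        trop v g x = aff c a x := by
      intro x hx
      rw [htrop, aff, dot_sum_right, ← Finset.sum_add_distrib]
      exact Finset.sum_congr rfl fun d hd => (hx d hd).tropMin_eq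
    rw [hcell]
    intro i hi
    -- A term i of g minimal at w coincides on σ with the sum of the weights of the `J d`. As σ has
    -- interior points, the two affine functions are identical, and so agree at w' too.
    have haff : ∀ x ∈ σ, aff (val v (coeff i.1 g)) i.1 x = aff c a x := by
      intro x hx
      rw [← hsum x fun d hd => hpersist hw hx d hd _ (hmin hw d (Finset.mem_Icc.1 hd).2)]
      rw [hcell] at hx
      exact (hx i hi).tropMin_eq.symm
    obtain ⟨h1, h2⟩ := aff_eq_of_le_of_interior hw (fun x hx => (haff x hx).le)
      (haff _ (interior_subset hw))
    rw [isArgmin_iff]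
    calc _ = aff c a (toReal w') := hsum _ fun d _ => hmin' d
      _ = _ := by rw [← h1, ← h2]

end InitialMonomial

end TropGrobner

open TropGrobner
theorem theoremt {K : Type*} [Field K] (v : AddValuation K (WithTop ℝ))
    (hΓ : ∀ q : ℚ, (q : ℝ) ∈ valueGroup v) (t : Splitting v) {n : ℕ}
    (I : Ideal (MvPolynomial (Fin (n + 1)) K))
    (hI : IsHomogeneousIdeal I)
    {s N : ℕ → ℕ} (b : ∀ d, Module.Basis (Fin (s d)) K (degreePart I d))
    (e : ∀ d, Fin (N d) ≃ Mon n d) :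
    BddAbove (generatorDegrees t I) ∧
    groebnerPoly t I b e ≠ 0 ∧
    (∃ S : PolyComplex (n + 1), S.IsCoarsest (trop v (groebnerPoly t I b e))) ∧
    ∀ S : PolyComplex (n + 1), S.IsCoarsest (trop v (groebnerPoly t I b e)) →
      ∀ σ, Maximal (fun P => P ∈ S.cells) σ →
        ∀ w : Fin (n + 1) → valueGroup v, toReal w ∈ interior σ →
          σ = closure (initialClass t I w) ∧ IsMonomialIdeal (initialIdeal t w I) :=
  ⟨bddAbove_generatorDegrees b e hI, groebnerPoly_ne_zero t b e,
    -- By definition trop(g) is a `tropMin` over the support of g, which is nonempty because g ≠ 0.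
    ⟨minComplex _ _, minComplex_isCoarsest _ _⟩,
    fun _ hS _ hσ _ hw => maximal_cell_eq_closure_initialClass hΓ hI hS hσ hw⟩
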